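/- Let $\hat u(X)=\int e^{-i x\cdot X}u(x)\,dx$ denote the Fourier transform on $\mathbb R^{1+3}$, with frequency variable $X=(\tau,\xi)$, $\tau\in\mathbb R$, $\xi\in\mathbb R^3$, and let $\|\cdot\|$ be the norm of $L^2(\mathbb R^{1+3})$. For a sign $\pm$ and $N,L>0$ put $$K^{\pm}_{N,L}=\{(\tau,\xi): N/2<|\xi|\le N,\ |-\tau\pm|\xi||\le L\}.$$ For $r>0$ and a unit vector $\omega\in\mathbb R^3$ let $T_r(\omega)\subset\mathbb R^3$ be the set of points at distance at most $r$ from the line $\mathbb R\omega$, and let $\mathbf P_{\mathbb R\times T_r(\omega)}$ be the Fourier multiplier whose symbol is the characteristic function of $\mathbb R\times T_r(\omega)$. For signs $\pm_1,\pm_2$ let $\theta_{12}\in[0,\pi]$ be the angle between $\pm_1\xi_1$ and $\pm_2\xi_2$, and let $\mathfrak B_{\theta_{12}}(u_1,u_2)$ be the function whose Fourier transform is $$X_0\mapsto\int \theta_{12}\,\hat u_1(X_1)\,\hat u_2(X_0-X_1)\,dX_1 ,\qquad X_1=(\tau_1,\xi_1),\quad X_0-X_1=(\tau_2,\xi_2).$$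 **Theorem.** (i) There is an absolute constant $C$ such that for all signs $\pm_1,\pm_2$, all $N_1,N_2,L_1,L_2,r>0$, all unit vectors $\omega\in\mathbb R^3$, and all $u_1,u_2\in L^2(\mathbb R^{1+3})$ such that $\hat u_j$ is supported in $K^{\pm_j}_{N_j,L_j}$ for $j=1,2$, the null form $\mathfrak B_{\theta_{12}}(\mathbf P_{\mathbb R\times T_r(\omega)}u_1,u_2)$ is a well-defined element of $L^2(\mathbb R^{1+3})$ and $$\|\mathfrak B_{\theta_{12}}(\mathbf P_{\mathbb R\times T_r(\omega)}u_1,u_2)\|\le C\,(r^2L_1L_2)^{1/2}\,\|u_1\|\,\|u_2\|.$$ (ii) The estimate is optimal up to an absolute factor: there is an absolute constant $c>0$ such that for all signs $\pm_1,\pm_2$, all $N\ge L>0$ and all unit vectors $\omega$, with $r=(NL)^{1/2}$, $N_1=N_2=N$ and $L_1=L_2=L$, there are nonzero $u_1,u_2\in L^2(\mathbb R^{1+3})$ such that $\hat u_j$ is supported in $K^{\pm_j}_{N,L}$ for $j=1,2$ and $$\|\mathfrak B_{\theta_{12}}(\mathbf P_{\mathbb R\times T_r(\omega)}u_1,u_2)\|\ge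 c\,(r^2L_1L_2)^{1/2}\,\|u_1\|\,\|u_2\|.$$ -/

import Mathlib

open MeasureTheory Set
open scoped FourierTransform

/-- The space `ℝ³` with its Euclidean structure. -/
abbrev Space3 : Type := EuclideanSpace ℝ (Fin 3)

/-- The space `ℝ^{1+3}` with its Euclidean structure. A point is `X = (τ, ξ)` (or `(t, x)`), with
`X.fst : ℝ` and `X.snd : Space3`. -/
abbrev SpaceTime : Type := WithLp 2 (ℝ × Space3)

/-- The complex Hilbert space `L²(ℝ^{1+3})` (Lebesgue measure). -/
abbrev L2SpaceTime : Type := Lp ℂ 2 (volume : Measure SpaceTime)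

/-- The Fourier transform `û(X) = ∫ e^{-i x·X} u(x) dx` of `u ∈ L²(ℝ^{1+3})`, extended from Schwartz
functions by Plancherel. Mathlib's `𝓕` is the one with kernel `e^{-2πi x·X}`, whence the dilation.
It is defined up to null sets, as any element of `L²`. -/
noncomputable def fourierHat (u : L2SpaceTime) (X : SpaceTime) : ℂ :=
  (𝓕 u : L2SpaceTime) ((2 * Real.pi)⁻¹ • X)

/-- The preimage of a measurable set under the dilation that relates the two normalizations of the
Fourier transform is measurable. -/
theorem measurableSet_dilate {A : Set SpaceTime} (hA : MeasurableSet A) :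
    MeasurableSet ((fun X : SpaceTime => (2 * Real.pi) • X) ⁻¹' A) :=
  (measurable_const_smul (2 * Real.pi)) hA

/-- Multiplication of `g ∈ L²(ℝ^{1+3})` by the characteristic function of a measurable set. -/
noncomputable def cutoff {A : Set SpaceTime} (hA : MeasurableSet A) (g : L2SpaceTime) :
    L2SpaceTime :=
  ((Lp.memLp g).indicator hA).toLp (A.indicator g)

/-- The Fourier restriction operator (multiplier) `P_A` on `L²(ℝ^{1+3})`: the Fourier transform of
`P_A u` is `χ_A û`. -/
noncomputable def fourierProj {A : Set SpaceTime} (hA : MeasurableSet A) (u : L2SpaceTime) :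
    L2SpaceTime :=
  𝓕⁻ (cutoff (measurableSet_dilate hA) (𝓕 u))

/-- The real number `+1` or `-1` attached to a sign. -/
def signVal (s : ℤˣ) : ℝ := ((s : ℤ) : ℝ)

/-- The thickened truncated cone
`K^±_{N,L} = {(τ, ξ) : N/2 < |ξ| ≤ N, |-τ ± |ξ|| ≤ L}`. -/
def thickCone (s : ℤˣ) (N L : ℝ) : Set SpaceTime :=
  {X | N / 2 < ‖X.snd‖ ∧ ‖X.snd‖ ≤ N ∧ |-X.fst + signVal s * ‖X.snd‖| ≤ L}

/-- The Fourier transform of `u` is supported in `A`, i.e. vanishes almost everywhere outside. -/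
def FourierSupportedIn (u : L2SpaceTime) (A : Set SpaceTime) : Prop :=
  ∀ᵐ X : SpaceTime, X ∉ A → fourierHat u X = 0

/-- The tube of radius `r` around the axis `ℝω` in `ℝ³`. -/
def tube (r : ℝ) (ω : Space3) : Set Space3 :=
  {ξ | Metric.infDist ξ (Submodule.span ℝ {ω} : Set Space3) ≤ r}

/-- The set `ℝ × T_r(ω)` in `ℝ^{1+3}`. -/
def spaceTimeTube (r : ℝ) (ω : Space3) : Set SpaceTime :=
  {X | X.snd ∈ tube r ω}

theorem measurableSet_spaceTimeTube (r : ℝ) (ω : Space3) :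
    MeasurableSet (spaceTimeTube r ω) := by
  have h : Continuous fun X : SpaceTime =>
      Metric.infDist X.snd (Submodule.span ℝ {ω} : Set Space3) :=
    (Metric.continuous_infDist_pt _).comp (by fun_prop)
  exact (isClosed_le h continuous_const).measurableSet

/-- The angle `θ₁₂ = θ(±₁ξ₁, ±₂ξ₂) ∈ [0, π]`. -/
noncomputable def theta12 (s₁ s₂ : ℤˣ) (X₁ X₂ : SpaceTime) : ℝ :=
  InnerProductGeometry.angle (signVal s₁ • X₁.snd) (signVal s₂ • X₂.snd)

/-- The integrand of the null form on the Fourier side, where `X₂ = X₀ - X₁`. -/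
noncomputable def nullFormIntegrand (s₁ s₂ : ℤˣ) (u₁ u₂ : L2SpaceTime) (X₀ X₁ : SpaceTime) : ℂ :=
  (theta12 s₁ s₂ X₁ (X₀ - X₁) : ℂ) * fourierHat u₁ X₁ * fourierHat u₂ (X₀ - X₁)

/-- `b ∈ L²(ℝ^{1+3})` is the null form `𝔅_{θ₁₂}(u₁, u₂)`: its Fourier transform at almost every `X₀`
is the (absolutely convergent) integral of `θ₁₂ û₁(X₁) û₂(X₂)` over `X₁ + X₂ = X₀`.
There is at most one such `b`. -/
def IsNullForm (s₁ s₂ : ℤˣ) (u₁ u₂ b : L2SpaceTime) : Prop :=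
  ∀ᵐ X₀ : SpaceTime, Integrable (nullFormIntegrand s₁ s₂ u₁ u₂ X₀) volume ∧
    fourierHat b X₀ = ∫ X₁, nullFormIntegrand s₁ s₂ u₁ u₂ X₀ X₁

/-! Upper bound. Cauchy–Schwarz in `X₁`, pairing `θ₁₂ χ_E` (with `E` the set of interacting `X₁`)
against `û₁ û₂`, followed by Tonelli, reduces everything to a bound for `∫_E θ₁₂²` by `r² L₁ L₂`,
uniform in `X₀`. For fixed `ξ`, the variable `τ` ranges over a set of length at most `2 min(L₁,
L₂)`, and eliminating it confines the phase `φ(ξ) = ±₁|ξ| ±₂ |ξ₀ - ξ|` to an interval `I` of length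
`2(L₁ + L₂)`.

The decisive point is that `∇φ = e₁ - e₂` is the difference of the unit vectors that span `θ₁₂`, so
`θ₁₂²` is comparable to `|∇φ|²`. As both vectors are unit, `|e₁ - e₂|² = 2 e₁ · (e₁ - e₂)`, which is
linear in the gradient; in the tube, the components of `e₁` across `ω` are at most `2r/N₁`. Hence
`θ₁₂² ≲ |∂₀φ| + (r/N₁)(|∂₁φ| + |∂₂φ|)` (`angle_sq_le`). Along any line that avoids `0` and `ξ₀`, `φ`
takes each value at most twice or is constant, so the integral of `|∂ᵢφ|` over the part where `φ ∈
I` is at most `2|I|`, without any nondegeneracy assumption. Multiplying by the area of the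
cross-section, `r²` for `i = 0` and `N₁ r` for `i = 1, 2`, gives `r² |I|` in total
(`lintegral_angle_sq_le`).

Optimality. The cones of both signs are, within `L`, flat along the hyperplane `τ = ξ·ω` on boxes of
length `N` along `ω` and width `r = √(NL)` across it. Taking the transforms to be indicators of two
translates of one such box, on opposite sides of the axis so that `θ₁₂ ≳ r/N`, makes every
inequality above sharp up to a constant. -/

/-! ### Change of variables in one variable -/

/-- A differentiable function whose derivative has at most one zero, or vanishes identically, covers
each value at most twice, in the sense of the change of variables formula. -/
theorem lintegral_abs_deriv_preimage_le {h h' : ℝ → ℝ} (hd : ∀ t, HasDerivAt h (h' t) t)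
    (hz : (∀ t, h' t = 0) ∨ ∃ t₀, ∀ t, h' t = 0 → t = t₀) {I : Set ℝ} (hI : MeasurableSet I) :
    ∫⁻ t in h ⁻¹' I, ENNReal.ofReal |h' t| ≤ 2 * volume I := by
  rcases hz with hz | ⟨t₀, ht₀⟩
  · simp [hz]
  have hcont : Continuous h := continuous_iff_continuousAt.2 fun t => (hd t).continuousAt
  have hmI : MeasurableSet (h ⁻¹' I) := hcont.measurable hI
  -- On an interval without `t₀`, Rolle's theorem makes `h` injective, so the integral is the
  -- measure of an image contained in `I`.
  have key : ∀ S : Set ℝ, MeasurableSet S → OrdConnected S → t₀ ∉ S →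
      ∫⁻ t in S ∩ h ⁻¹' I, ENNReal.ofReal |h' t| ≤ volume I := by
    intro S hS hconn ht
    have hlt : ∀ a ∈ S, ∀ b ∈ S, a < b → h a ≠ h b := by
      intro a ha b hb hab heq
      obtain ⟨c, hc, hc'⟩ := exists_hasDerivAt_eq_zero hab hcont.continuousOn heq
        (fun x _ => hd x)
      exact ht (ht₀ c hc' ▸ hconn.out ha hb (Ioo_subset_Icc_self hc))
    have hinj : InjOn h (S ∩ h ⁻¹' I) := by
      intro a ha b hb heq
      rcases lt_trichotomy a b with hab | hab | hab
      · exact absurd heq (hlt a ha.1 b hb.1 hab)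
      · exact hab
      · exact absurd heq.symm (hlt b hb.1 a ha.1 hab)
    have := lintegral_image_eq_lintegral_abs_deriv_mul (hS.inter hmI)
      (fun x _ => (hd x).hasDerivWithinAt) hinj (fun _ => 1)
    simp only [mul_one, lintegral_const, MeasurableSet.univ, Measure.restrict_apply, univ_inter,
      one_mul] at this
    rw [← this]
    exact measure_mono (image_subset_iff.2 inter_subset_right)
  have hsub : h ⁻¹' I ⊆ ((Iio t₀ ∩ h ⁻¹' I) ∪ (Ioi t₀ ∩ h ⁻¹' I)) ∪ {t₀} := by
    intro t ht
    rcases lt_trichotomy t t₀ with hab | hab | hab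
    · exact Or.inl (Or.inl ⟨hab, ht⟩)
    · exact Or.inr hab
    · exact Or.inl (Or.inr ⟨hab, ht⟩)
  calc ∫⁻ t in h ⁻¹' I, ENNReal.ofReal |h' t|
      ≤ ∫⁻ t in ((Iio t₀ ∩ h ⁻¹' I) ∪ (Ioi t₀ ∩ h ⁻¹' I)) ∪ {t₀}, ENNReal.ofReal |h' t| :=
        lintegral_mono_set hsub
    _ ≤ (∫⁻ t in (Iio t₀ ∩ h ⁻¹' I) ∪ (Ioi t₀ ∩ h ⁻¹' I), ENNReal.ofReal |h' t|)
          + ∫⁻ t in {t₀}, ENNReal.ofReal |h' t| := lintegral_union_le _ _ _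
    _ ≤ ((∫⁻ t in Iio t₀ ∩ h ⁻¹' I, ENNReal.ofReal |h' t|)
          + ∫⁻ t in Ioi t₀ ∩ h ⁻¹' I, ENNReal.ofReal |h' t|) + 0 := by
        gcongr
        · exact lintegral_union_le _ _ _
        · simp
    _ ≤ (volume I + volume I) + 0 := by
        gcongr
        · exact key _ measurableSet_Iio ordConnected_Iio (by simp)
        · exact key _ measurableSet_Ioi ordConnected_Ioi (by simp)
    _ = 2 * volume I := by rw [add_zero, two_mul]

theorem signVal_sq (s : ℤˣ) : signVal s ^ 2 = 1 := by
  rcases Int.units_eq_one_or s with rfl | rfl <;> simp [signVal]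

theorem abs_signVal (s : ℤˣ) : |signVal s| = 1 := by
  rcases Int.units_eq_one_or s with rfl | rfl <;> simp [signVal]

theorem signVal_eq (s : ℤˣ) : signVal s = 1 ∨ signVal s = -1 := by
  rcases Int.units_eq_one_or s with rfl | rfl <;> simp [signVal]

/-- `x ↦ x / √(x² + a²)` takes the same value at `p` (for `a`) and `q` (for `b`) only if `p / a = q / b`. -/
theorem mul_eq_mul_of_div_sqrt_eq {p q a b : ℝ} (ha : 0 < a) (hb : 0 < b)
    (h : p / √(p ^ 2 + a ^ 2) = q / √(q ^ 2 + b ^ 2)) : p * b = q * a := by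
  have hA : 0 < √(p ^ 2 + a ^ 2) := Real.sqrt_pos.2 (by positivity)
  have hB : 0 < √(q ^ 2 + b ^ 2) := Real.sqrt_pos.2 (by positivity)
  have hA2 : √(p ^ 2 + a ^ 2) ^ 2 = p ^ 2 + a ^ 2 := Real.sq_sqrt (by positivity)
  have hB2 : √(q ^ 2 + b ^ 2) ^ 2 = q ^ 2 + b ^ 2 := Real.sq_sqrt (by positivity)
  set A := √(p ^ 2 + a ^ 2)
  set B := √(q ^ 2 + b ^ 2)
  rw [div_eq_div_iff hA.ne' hB.ne'] at h
  -- Squaring leaves `p b = ± q a`; the sign is settled by `p q ≥ 0`, since both quotients have the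
  -- same sign.
  have h2 : p ^ 2 * B ^ 2 = q ^ 2 * A ^ 2 := by rw [← mul_pow, ← mul_pow, h]
  rw [hA2, hB2] at h2
  have h3 : (p * b) ^ 2 = (q * a) ^ 2 := by nlinarith
  have hpq : 0 ≤ p * q := by
    have : p * q * (B * A) = (q * A) ^ 2 := by rw [← mul_one (p * q)]; nlinarith
    by_contra hneg
    push Not at hneg
    nlinarith [mul_pos hB hA, sq_nonneg (q * A), mul_neg_of_neg_of_pos hneg (mul_pos hB hA)]
  rcases sq_eq_sq_iff_eq_or_eq_neg.1 h3 with h4 | h4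
  · exact h4
  · have h5 : 0 ≤ (p * b) * (q * a) := by
      have := mul_nonneg hpq (mul_pos ha hb).le
      nlinarith
    rw [h4] at h5 ⊢
    nlinarith [sq_nonneg (q * a)]

theorem hasDerivAt_sqrt_sq_add {a : ℝ} (ha : 0 < a) (t : ℝ) :
    HasDerivAt (fun t => √(t ^ 2 + a ^ 2)) (t / √(t ^ 2 + a ^ 2)) t := by
  have h := ((hasDerivAt_pow 2 t).add_const (a ^ 2)).sqrt (by positivity)
  convert h using 1
  field_simp
  simp [mul_comm]

/-- The sum or difference of the distances to two points, restricted to a line which avoids them,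
satisfies the hypotheses of the change of variables bound. -/
theorem lintegral_abs_deriv_cone_line_le (s₁ s₂ : ℤˣ) {a b : ℝ} (c : ℝ) (ha : 0 < a) (hb : 0 < b)
    {I : Set ℝ} (hI : MeasurableSet I) :
    ∫⁻ t in (fun t => signVal s₁ * √(t ^ 2 + a ^ 2) + signVal s₂ * √((c - t) ^ 2 + b ^ 2)) ⁻¹' I,
      ENNReal.ofReal |signVal s₁ * (t / √(t ^ 2 + a ^ 2))
        - signVal s₂ * ((c - t) / √((c - t) ^ 2 + b ^ 2))| ≤ 2 * volume I := by
  refine lintegral_abs_deriv_preimage_le (fun t => ?_) ?_ hI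
  · have h1 := (hasDerivAt_sqrt_sq_add ha t).const_mul (signVal s₁)
    have h2 := ((hasDerivAt_sqrt_sq_add hb (c - t)).comp t
      ((hasDerivAt_id t).const_sub c)).const_mul (signVal s₂)
    exact (h1.add h2).congr_deriv (by ring)
  · have hlin : ∀ t, signVal s₁ * (t / √(t ^ 2 + a ^ 2))
        - signVal s₂ * ((c - t) / √((c - t) ^ 2 + b ^ 2)) = 0 →
        signVal s₁ * t * b = signVal s₂ * (c - t) * a := by
      intro t ht
      refine mul_eq_mul_of_div_sqrt_eq ha hb ?_
      rw [mul_pow, mul_pow, signVal_sq, signVal_sq, one_mul, one_mul, mul_div_assoc, mul_div_assoc]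
      linarith
    -- Critical points solve a linear equation in `t` with this leading coefficient. If it vanishes,
    -- then `a = b` and the signs are opposite: for `c = 0` the derivative is identically zero, and
    -- otherwise it has no zero, so any `t₀` serves.
    by_cases hne : signVal s₁ * b + signVal s₂ * a = 0
    · by_cases hc : c = 0
      · left
        intro t
        have hab : a = b ∧ signVal s₂ = -signVal s₁ := by
          rcases signVal_eq s₁ with h1 | h1 <;> rcases signVal_eq s₂ with h2 | h2 <;>
            rw [h1, h2] at hne ⊢ <;> constructor <;> linarith
        rw [hab.1, hab.2, hc]
        have h0 : (0 - t) ^ 2 = t ^ 2 := by ring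
        rw [h0]
        ring
      · right
        refine ⟨0, fun t ht => ?_⟩
        exfalso
        have := hlin t ht
        have h3 : signVal s₂ * c * a = 0 := by linear_combination t * hne - this
        have h4 : signVal s₂ ≠ 0 := fun h => by simpa [h] using signVal_sq s₂
        exact mul_ne_zero (mul_ne_zero h4 hc) ha.ne' h3
    · right
      refine ⟨signVal s₂ * c * a / (signVal s₁ * b + signVal s₂ * a), fun t ht => ?_⟩
      rw [eq_div_iff hne]
      linear_combination hlin t ht

/-! ### Integration along coordinate lines in an orthonormal frame -/

/-- The point whose `i`-th coordinate in the orthonormal basis `b` is `t`, the others being `y`. -/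
noncomputable def lineCoord (b : OrthonormalBasis (Fin 3) ℝ Space3) (i : Fin 3) (t : ℝ)
    (y : Fin 2 → ℝ) : Space3 :=
  b.repr.symm (WithLp.toLp 2 (i.insertNth t y))

theorem repr_lineCoord (b : OrthonormalBasis (Fin 3) ℝ Space3) (i : Fin 3) (t : ℝ)
    (y : Fin 2 → ℝ) (j : Fin 3) : b.repr (lineCoord b i t y) j = i.insertNth (α := fun _ => ℝ) t y j := by
  simp [lineCoord]

theorem exists_lineCoord (b : OrthonormalBasis (Fin 3) ℝ Space3) (i : Fin 3) (ξ : Space3) :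
    ∃ t y, ξ = lineCoord b i t y := by
  refine ⟨b.repr ξ i, fun j => b.repr ξ (i.succAbove j), ?_⟩
  apply b.repr.injective
  ext j
  rw [repr_lineCoord]
  refine Fin.succAboveCases i ?_ (fun k => ?_) j <;> simp

theorem lineCoord_sub (b : OrthonormalBasis (Fin 3) ℝ Space3) (i : Fin 3) (t t' : ℝ)
    (y y' : Fin 2 → ℝ) : lineCoord b i t y - lineCoord b i t' y' = lineCoord b i (t - t') (y - y') := by
  apply b.repr.injective
  ext j
  rw [map_sub, PiLp.sub_apply, repr_lineCoord, repr_lineCoord, repr_lineCoord]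
  refine Fin.succAboveCases i ?_ (fun k => ?_) j <;> simp

theorem norm_lineCoord (b : OrthonormalBasis (Fin 3) ℝ Space3) (i : Fin 3) (t : ℝ)
    (y : Fin 2 → ℝ) : ‖lineCoord b i t y‖ = √(t ^ 2 + √(∑ j, y j ^ 2) ^ 2) := by
  rw [← b.repr.norm_map, EuclideanSpace.norm_eq, Fin.sum_univ_succAbove _ i,
    Real.sq_sqrt (Finset.sum_nonneg fun _ _ => sq_nonneg _)]
  simp only [repr_lineCoord, Fin.insertNth_apply_same, Fin.insertNth_apply_succAbove,
    Real.norm_eq_abs, sq_abs]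

theorem measurePreserving_lineCoord (b : OrthonormalBasis (Fin 3) ℝ Space3) (i : Fin 3) :
    MeasurePreserving (fun p : ℝ × (Fin 2 → ℝ) => lineCoord b i p.1 p.2) volume volume :=
  (b.measurePreserving_repr_symm.comp (PiLp.volume_preserving_toLp (Fin 3))).comp
    (volume_preserving_piFinSuccAbove (fun _ => ℝ) i).symm

theorem lintegral_eq_lintegral_lineCoord (b : OrthonormalBasis (Fin 3) ℝ Space3) (i : Fin 3)
    {F : Space3 → ENNReal} (hF : Measurable F) :
    ∫⁻ ξ, F ξ = ∫⁻ y, ∫⁻ t, F (lineCoord b i t y) := by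
  have hm := measurePreserving_lineCoord b i
  rw [← hm.lintegral_comp hF]
  exact lintegral_prod_symm' _ (hF.comp hm.measurable)

/-! ### The phase function and its gradient -/

/-- The component along `b i` of the gradient of `ξ ↦ ±₁|ξ| ±₂ |ξ₀ - ξ|`. -/
noncomputable def coneGrad (s₁ s₂ : ℤˣ) (b : OrthonormalBasis (Fin 3) ℝ Space3) (ξ₀ : Space3)
    (i : Fin 3) (ξ : Space3) : ℝ :=
  signVal s₁ * (b.repr ξ i / ‖ξ‖) - signVal s₂ * (b.repr (ξ₀ - ξ) i / ‖ξ₀ - ξ‖)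

/-- The phase function `±₁|ξ| ±₂ |ξ₀ - ξ|`. -/
noncomputable def conePhase (s₁ s₂ : ℤˣ) (ξ₀ ξ : Space3) : ℝ :=
  signVal s₁ * ‖ξ‖ + signVal s₂ * ‖ξ₀ - ξ‖

theorem continuous_conePhase (s₁ s₂ : ℤˣ) (ξ₀ : Space3) : Continuous (conePhase s₁ s₂ ξ₀) := by
  unfold conePhase; fun_prop

theorem measurable_coneGrad (s₁ s₂ : ℤˣ) (b : OrthonormalBasis (Fin 3) ℝ Space3) (ξ₀ : Space3)
    (i : Fin 3) : Measurable (coneGrad s₁ s₂ b ξ₀ i) := by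
  have h : Measurable fun ξ : Space3 => b.repr ξ i :=
    Continuous.measurable (by fun_prop)
  unfold coneGrad
  exact ((h.div measurable_norm).const_mul _).sub
    (((h.comp (measurable_const.sub measurable_id)).div
      (measurable_norm.comp (measurable_const.sub measurable_id))).const_mul _)

/-- The box with half-sides `R j` along the axes of `b`. -/
def coordBox (b : OrthonormalBasis (Fin 3) ℝ Space3) (R : Fin 3 → ℝ) : Set Space3 :=
  {ξ | ∀ j, |b.repr ξ j| ≤ R j}

theorem measurableSet_coordBox (b : OrthonormalBasis (Fin 3) ℝ Space3) (R : Fin 3 → ℝ) :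
    MeasurableSet (coordBox b R) := by
  refine IsClosed.measurableSet ?_
  simp only [coordBox, ofPred_forall]
  exact isClosed_iInter fun j => isClosed_le (by fun_prop) continuous_const

/-- Tonelli in the direction `b i`: the integrand is the absolute derivative of the phase along each
line, so a line contributes at most `2 |I|`. The product is the area of the cross-section of the
box. -/
theorem lintegral_coneGrad_le (s₁ s₂ : ℤˣ) (b : OrthonormalBasis (Fin 3) ℝ Space3) (ξ₀ : Space3)
    (i : Fin 3) (R : Fin 3 → ℝ) {I : Set ℝ} (hI : MeasurableSet I) :
    ∫⁻ ξ in coordBox b R ∩ conePhase s₁ s₂ ξ₀ ⁻¹' I, ENNReal.ofReal |coneGrad s₁ s₂ b ξ₀ i ξ| ≤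
      2 * volume I * ∏ j : Fin 2, ENNReal.ofReal (2 * R (i.succAbove j)) := by
  have hS : MeasurableSet (coordBox b R ∩ conePhase s₁ s₂ ξ₀ ⁻¹' I) :=
    (measurableSet_coordBox b R).inter ((continuous_conePhase s₁ s₂ ξ₀).measurable hI)
  have hF : Measurable ((coordBox b R ∩ conePhase s₁ s₂ ξ₀ ⁻¹' I).indicator
      fun ξ => ENNReal.ofReal |coneGrad s₁ s₂ b ξ₀ i ξ|) :=
    (measurable_coneGrad s₁ s₂ b ξ₀ i).norm.ennreal_ofReal.indicator hS
  rw [← lintegral_indicator hS, lintegral_eq_lintegral_lineCoord b i hF]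
  obtain ⟨c, z, rfl⟩ := exists_lineCoord b i ξ₀
  set B : Set (Fin 2 → ℝ) := Icc (fun j => -R (i.succAbove j)) (fun j => R (i.succAbove j))
  have hpos : ∀ y : Fin 2 → ℝ, y ≠ 0 → 0 < √(∑ j, y j ^ 2) := by
    intro y hy
    obtain ⟨j, hj⟩ := Function.ne_iff.1 hy
    exact Real.sqrt_pos.2 (Finset.sum_pos' (fun _ _ => sq_nonneg _)
      ⟨j, Finset.mem_univ _, pow_pos (abs_pos.2 hj) 2 |>.trans_eq (sq_abs _)⟩)
  -- The lines through `0` and through `ξ₀`, where the phase is not smooth, are discarded as a null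
  -- set.
  have hae : ∀ᵐ y : Fin 2 → ℝ, y ≠ 0 ∧ y ≠ z := by
    have h1 : ∀ w : Fin 2 → ℝ, ∀ᵐ y : Fin 2 → ℝ, y ≠ w := fun w => by
      rw [ae_iff]; simp
    filter_upwards [h1 0, h1 z] with y hy hy' using ⟨hy, hy'⟩
  calc _ ≤ ∫⁻ y, B.indicator (fun _ => 2 * volume I) y := by
        refine lintegral_mono_ae ?_
        filter_upwards [hae] with y hy
        have ha := hpos y hy.1
        have hb := hpos (z - y) (sub_ne_zero.2 hy.2.symm)
        by_cases hyB : y ∈ B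
        · rw [indicator_of_mem hyB]
          have key := lintegral_abs_deriv_cone_line_le s₁ s₂ c ha hb hI
          rw [← lintegral_indicator (Continuous.measurable (by fun_prop) hI)] at key
          refine le_trans (lintegral_mono fun t => ?_) key
          have hg : coneGrad s₁ s₂ b (lineCoord b i c z) i (lineCoord b i t y) =
              signVal s₁ * (t / √(t ^ 2 + √(∑ j, y j ^ 2) ^ 2)) - signVal s₂ *
                ((c - t) / √((c - t) ^ 2 + √(∑ j, (z - y) j ^ 2) ^ 2)) := by
            simp only [coneGrad, lineCoord_sub, norm_lineCoord, repr_lineCoord,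
              Fin.insertNth_apply_same]
          by_cases ht : lineCoord b i t y ∈
              coordBox b R ∩ conePhase s₁ s₂ (lineCoord b i c z) ⁻¹' I
          · rw [indicator_of_mem ht, indicator_of_mem, hg]
            have := ht.2
            simpa only [mem_preimage, conePhase, lineCoord_sub, norm_lineCoord] using this
          · rw [indicator_of_notMem ht]
            exact zero_le
        · rw [indicator_of_notMem hyB, nonpos_iff_eq_zero, ← lintegral_zero]
          congr 1 with t
          refine indicator_of_notMem (fun h => hyB ?_) _
          have h' : ∀ j, |y j| ≤ R (i.succAbove j) := fun j => by
            have := h.1 (i.succAbove j)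
            rwa [repr_lineCoord, Fin.insertNth_apply_succAbove] at this
          exact ⟨fun j => (abs_le.1 (h' j)).1, fun j => (abs_le.1 (h' j)).2⟩
    _ = _ := by
        rw [lintegral_indicator measurableSet_Icc, setLIntegral_const, Real.volume_Icc_pi]
        congr! 3
        ring

/-! ### Frames adapted to the axis of the tube -/

theorem exists_orthonormalBasis_apply_zero_eq {ω : Space3} (hω : ‖ω‖ = 1) :
    ∃ b : OrthonormalBasis (Fin 3) ℝ Space3, b 0 = ω := by
  obtain ⟨b, hb⟩ := Orthonormal.exists_orthonormalBasis_extension_of_card_eq (𝕜 := ℝ)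
    (E := Space3) (ι := Fin 3) (by simp) (v := fun _ => ω) (s := {0})
    ⟨fun _ => hω, fun i j hij => absurd (Subsingleton.elim i j) hij⟩
  exact ⟨b, hb 0 rfl⟩

theorem norm_sq_eq_sum_repr (b : OrthonormalBasis (Fin 3) ℝ Space3) (ξ : Space3) :
    ‖ξ‖ ^ 2 = b.repr ξ 0 ^ 2 + b.repr ξ 1 ^ 2 + b.repr ξ 2 ^ 2 := by
  rw [← b.repr.norm_map, EuclideanSpace.norm_sq_eq, Fin.sum_univ_three]
  simp only [Real.norm_eq_abs, sq_abs]

theorem inner_eq_sum_repr (b : OrthonormalBasis (Fin 3) ℝ Space3) (ξ η : Space3) :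
    inner ℝ ξ η = b.repr ξ 0 * b.repr η 0 + b.repr ξ 1 * b.repr η 1 + b.repr ξ 2 * b.repr η 2 := by
  rw [← b.repr.inner_map_map, PiLp.inner_apply, Fin.sum_univ_three]
  simp [mul_comm]

theorem abs_repr_le_norm (b : OrthonormalBasis (Fin 3) ℝ Space3) (ξ : Space3) (j : Fin 3) :
    |b.repr ξ j| ≤ ‖ξ‖ := by
  rw [← b.repr.norm_map, ← Real.norm_eq_abs]
  exact PiLp.norm_apply_le _ j

theorem abs_repr_le_of_mem_tube {b : OrthonormalBasis (Fin 3) ℝ Space3} {ω : Space3}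
    (hb : b 0 = ω) {r : ℝ} {ξ : Space3} (hξ : ξ ∈ tube r ω) {j : Fin 3} (hj : j ≠ 0) :
    |b.repr ξ j| ≤ r := by
  refine le_trans ?_ hξ
  refine (Metric.le_infDist ⟨0, Submodule.zero_mem _⟩).2 fun η hη => ?_
  obtain ⟨t, rfl⟩ := Submodule.mem_span_singleton.1 hη
  have h : b.repr ξ j = b.repr (ξ - t • ω) j := by
    rw [map_sub, map_smul, ← hb, b.repr_self]
    simp [hj]
  rw [h, dist_eq_norm]
  exact abs_repr_le_norm b _ j

theorem mem_tube_of_sq_le {b : OrthonormalBasis (Fin 3) ℝ Space3} {ω : Space3}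
    (hb : b 0 = ω) {r : ℝ} (hr : 0 ≤ r) {ξ : Space3}
    (hξ : b.repr ξ 1 ^ 2 + b.repr ξ 2 ^ 2 ≤ r ^ 2) : ξ ∈ tube r ω := by
  refine (Metric.infDist_le_dist_of_mem (Submodule.mem_span_singleton.2 ⟨b.repr ξ 0, rfl⟩)).trans ?_
  rw [dist_eq_norm]
  refine abs_le_of_sq_le_sq' ?_ hr |>.2
  rw [norm_sq_eq_sum_repr b, map_sub, map_smul, ← hb, b.repr_self]
  simpa using hξ

/-! ### Comparison of the angle with the gradient -/

section Angle

variable (s₁ s₂ : ℤˣ) {b : OrthonormalBasis (Fin 3) ℝ Space3} {ξ η : Space3}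

/-- The squared distance of the unit vectors `±₁ξ/|ξ|` and `±₂η/|η|`. -/
theorem two_sub_two_cos_angle (b : OrthonormalBasis (Fin 3) ℝ Space3) (hξ : ξ ≠ 0) (hη : η ≠ 0) :
    2 - 2 * Real.cos (InnerProductGeometry.angle (signVal s₁ • ξ) (signVal s₂ • η)) =
      (signVal s₁ * (b.repr ξ 0 / ‖ξ‖) - signVal s₂ * (b.repr η 0 / ‖η‖)) ^ 2 +
      (signVal s₁ * (b.repr ξ 1 / ‖ξ‖) - signVal s₂ * (b.repr η 1 / ‖η‖)) ^ 2 +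
      (signVal s₁ * (b.repr ξ 2 / ‖ξ‖) - signVal s₂ * (b.repr η 2 / ‖η‖)) ^ 2 := by
  have hξ' : 0 < ‖ξ‖ := norm_pos_iff.2 hξ
  have hη' : 0 < ‖η‖ := norm_pos_iff.2 hη
  have h1 := norm_sq_eq_sum_repr b ξ
  have h2 := norm_sq_eq_sum_repr b η
  rw [InnerProductGeometry.cos_angle, norm_smul, norm_smul, Real.norm_eq_abs, Real.norm_eq_abs,
    abs_signVal, abs_signVal, inner_smul_left, inner_smul_right, inner_eq_sum_repr b, one_mul,
    one_mul]
  have h3 := signVal_sq s₁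
  have h4 := signVal_sq s₂
  simp only [conj_trivial]
  generalize signVal s₁ = a at *
  generalize signVal s₂ = c at *
  generalize b.repr ξ 0 = x0 at *
  generalize b.repr ξ 1 = x1 at *
  generalize b.repr ξ 2 = x2 at *
  generalize b.repr η 0 = y0 at *
  generalize b.repr η 1 = y1 at *
  generalize b.repr η 2 = y2 at *
  have hx : (x0 / ‖ξ‖) ^ 2 + (x1 / ‖ξ‖) ^ 2 + (x2 / ‖ξ‖) ^ 2 = 1 := by
    field_simp; linarith
  have hy : (y0 / ‖η‖) ^ 2 + (y1 / ‖η‖) ^ 2 + (y2 / ‖η‖) ^ 2 = 1 := by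
    field_simp; linarith
  have hxy : a * (c * (x0 * y0 + x1 * y1 + x2 * y2)) / (‖ξ‖ * ‖η‖) =
      a * c * ((x0 / ‖ξ‖) * (y0 / ‖η‖) + (x1 / ‖ξ‖) * (y1 / ‖η‖) + (x2 / ‖ξ‖) * (y2 / ‖η‖)) := by
    field_simp
  rw [hxy]
  linear_combination -a ^ 2 * hx - c ^ 2 * hy - h3 - h4

/-- The gain is that the right side is linear in the gradient, and that its transversal components
carry the small factor `ε`. This comes from `|u - v|² = 2 u · (u - v)` for unit vectors, with `u`
almost parallel to `b 0`. -/
theorem angle_sq_le (hξ : ξ ≠ 0) (hη : η ≠ 0) (b : OrthonormalBasis (Fin 3) ℝ Space3) {ε : ℝ}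
    (h1 : |b.repr ξ 1| ≤ ε * ‖ξ‖) (h2 : |b.repr ξ 2| ≤ ε * ‖ξ‖) :
    InnerProductGeometry.angle (signVal s₁ • ξ) (signVal s₂ • η) ^ 2 ≤
      5 * (|signVal s₁ * (b.repr ξ 0 / ‖ξ‖) - signVal s₂ * (b.repr η 0 / ‖η‖)| +
      ε * |signVal s₁ * (b.repr ξ 1 / ‖ξ‖) - signVal s₂ * (b.repr η 1 / ‖η‖)| +
      ε * |signVal s₁ * (b.repr ξ 2 / ‖ξ‖) - signVal s₂ * (b.repr η 2 / ‖η‖)|) := by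
  have hD := two_sub_two_cos_angle s₁ s₂ b hξ hη
  have hξ' : 0 < ‖ξ‖ := norm_pos_iff.2 hξ
  have hη' : 0 < ‖η‖ := norm_pos_iff.2 hη
  set θ := InnerProductGeometry.angle (signVal s₁ • ξ) (signVal s₂ • η)
  have hθ : |θ| ≤ Real.pi := by
    rw [abs_of_nonneg (InnerProductGeometry.angle_nonneg _ _)]
    exact InnerProductGeometry.angle_le_pi _ _
  -- A Jordan type inequality bounds `θ²` by `π²/4` times the squared chord; below, `π²/4 ≤ 5/2`
  -- produces the constant 5.
  have hcos := Real.cos_le_one_sub_mul_cos_sq hθ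
  have hpi : θ ^ 2 ≤ Real.pi ^ 2 / 4 * (2 - 2 * Real.cos θ) := by
    have hp : 0 < Real.pi ^ 2 := by positivity
    have h3 : 4 / Real.pi ^ 2 * θ ^ 2 ≤ 2 - 2 * Real.cos θ := by
      have : 4 / Real.pi ^ 2 = 2 * (2 / Real.pi ^ 2) := by ring
      rw [this]; linarith
    calc θ ^ 2 = Real.pi ^ 2 / 4 * (4 / Real.pi ^ 2 * θ ^ 2) := by field_simp
      _ ≤ _ := by gcongr
  have hu0 : |signVal s₁ * (b.repr ξ 0 / ‖ξ‖)| ≤ 1 := by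
    rw [abs_mul, abs_signVal, one_mul, abs_div, abs_of_pos hξ', div_le_one hξ']
    exact abs_repr_le_norm b ξ 0
  have hu1 : |signVal s₁ * (b.repr ξ 1 / ‖ξ‖)| ≤ ε := by
    rwa [abs_mul, abs_signVal, one_mul, abs_div, abs_of_pos hξ', div_le_iff₀ hξ']
  have hu2 : |signVal s₁ * (b.repr ξ 2 / ‖ξ‖)| ≤ ε := by
    rwa [abs_mul, abs_signVal, one_mul, abs_div, abs_of_pos hξ', div_le_iff₀ hξ']
  have hx : (signVal s₁ * (b.repr ξ 0 / ‖ξ‖)) ^ 2 + (signVal s₁ * (b.repr ξ 1 / ‖ξ‖)) ^ 2 +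
      (signVal s₁ * (b.repr ξ 2 / ‖ξ‖)) ^ 2 = 1 := by
    simp only [mul_pow, signVal_sq, div_pow, one_mul]
    rw [← add_div, ← add_div, ← norm_sq_eq_sum_repr b, div_self (by positivity)]
  have hy : (signVal s₂ * (b.repr η 0 / ‖η‖)) ^ 2 + (signVal s₂ * (b.repr η 1 / ‖η‖)) ^ 2 +
      (signVal s₂ * (b.repr η 2 / ‖η‖)) ^ 2 = 1 := by
    simp only [mul_pow, signVal_sq, div_pow, one_mul]
    rw [← add_div, ← add_div, ← norm_sq_eq_sum_repr b, div_self (by positivity)]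
  generalize signVal s₁ * (b.repr ξ 0 / ‖ξ‖) = u0 at *
  generalize signVal s₁ * (b.repr ξ 1 / ‖ξ‖) = u1 at *
  generalize signVal s₁ * (b.repr ξ 2 / ‖ξ‖) = u2 at *
  generalize signVal s₂ * (b.repr η 0 / ‖η‖) = v0 at *
  generalize signVal s₂ * (b.repr η 1 / ‖η‖) = v1 at *
  generalize signVal s₂ * (b.repr η 2 / ‖η‖) = v2 at *
  have hmul : ∀ {u g e : ℝ}, |u| ≤ e → u * g ≤ e * |g| := fun {u g e} h =>
    (le_abs_self _).trans ((abs_mul u g).trans_le (mul_le_mul_of_nonneg_right h (abs_nonneg _)))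
  have hsum : (u0 - v0) ^ 2 + (u1 - v1) ^ 2 + (u2 - v2) ^ 2 ≤
      2 * (|u0 - v0| + ε * |u1 - v1| + ε * |u2 - v2|) := by
    have e0 := hmul (g := u0 - v0) hu0
    have e1 := hmul (g := u1 - v1) hu1
    have e2 := hmul (g := u2 - v2) hu2
    nlinarith
  rw [hD] at hpi
  have hpi2 : Real.pi ^ 2 / 4 ≤ 5 / 2 := by nlinarith [Real.pi_lt_d2, Real.pi_pos]
  have hpos : 0 ≤ (u0 - v0) ^ 2 + (u1 - v1) ^ 2 + (u2 - v2) ^ 2 := by positivity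
  calc θ ^ 2 ≤ _ := hpi
    _ ≤ 5 / 2 * ((u0 - v0) ^ 2 + (u1 - v1) ^ 2 + (u2 - v2) ^ 2) := by gcongr
    _ ≤ _ := by linarith

end Angle

/-! ### The integral of the squared angle over the interaction set -/

/-- The part of the spatial frequency annulus inside the tube on which the phase lies in `I`. -/
def phaseSlab (s₁ s₂ : ℤˣ) (N r : ℝ) (ω ξ₀ : Space3) (I : Set ℝ) : Set Space3 :=
  {ξ | N / 2 < ‖ξ‖ ∧ ‖ξ‖ ≤ N ∧ ξ ∈ tube r ω ∧ ξ₀ - ξ ≠ 0 ∧ conePhase s₁ s₂ ξ₀ ξ ∈ I}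

/-- The weights balance the cross-sections: the axial derivative sees area `4r²`, while the
transversal ones see `4Nr` but come with `ε = 2r/N`. No power of `N` survives. -/
theorem lintegral_angle_sq_le (s₁ s₂ : ℤˣ) {N r : ℝ} (hN : 0 < N) (hr : 0 < r) {ω : Space3}
    (hω : ‖ω‖ = 1) (ξ₀ : Space3) {I : Set ℝ} (hI : MeasurableSet I) :
    ∫⁻ ξ in phaseSlab s₁ s₂ N r ω ξ₀ I, ENNReal.ofReal
        (InnerProductGeometry.angle (signVal s₁ • ξ) (signVal s₂ • (ξ₀ - ξ)) ^ 2) ≤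
      ENNReal.ofReal (200 * r ^ 2) * volume I := by
  obtain ⟨b, hb⟩ := exists_orthonormalBasis_apply_zero_eq hω
  set R : Fin 3 → ℝ := ![N, r, r]
  set T := coordBox b R ∩ conePhase s₁ s₂ ξ₀ ⁻¹' I
  set g := coneGrad s₁ s₂ b ξ₀
  have hε : 0 ≤ 2 * r / N := by positivity
  have hsub : phaseSlab s₁ s₂ N r ω ξ₀ I ⊆ T := by
    rintro ξ ⟨-, h2, h3, -, h5⟩
    refine ⟨fun j => ?_, h5⟩
    fin_cases j
    · exact (abs_repr_le_norm b ξ 0).trans h2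
    · exact abs_repr_le_of_mem_tube hb h3 (by decide)
    · exact abs_repr_le_of_mem_tube hb h3 (by decide)
  have hpt : ∀ ξ ∈ phaseSlab s₁ s₂ N r ω ξ₀ I, ENNReal.ofReal
        (InnerProductGeometry.angle (signVal s₁ • ξ) (signVal s₂ • (ξ₀ - ξ)) ^ 2) ≤
      ENNReal.ofReal 5 * (ENNReal.ofReal |g 0 ξ| + ENNReal.ofReal (2 * r / N) * ENNReal.ofReal |g 1 ξ|
        + ENNReal.ofReal (2 * r / N) * ENNReal.ofReal |g 2 ξ|) := by
    rintro ξ ⟨h1, h2, h3, h4, -⟩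
    rw [← ENNReal.ofReal_mul hε, ← ENNReal.ofReal_mul hε, ← ENNReal.ofReal_add (by positivity)
      (by positivity), ← ENNReal.ofReal_add (by positivity) (by positivity),
      ← ENNReal.ofReal_mul (by positivity)]
    refine ENNReal.ofReal_le_ofReal ?_
    have hξ : ξ ≠ 0 := norm_pos_iff.1 (by linarith)
    -- The lower bound `N/2 < ‖ξ‖` is what permits `ε = 2r/N`.
    have hle : r ≤ 2 * r / N * ‖ξ‖ := by
      rw [div_mul_eq_mul_div, le_div_iff₀ hN]
      nlinarith
    exact angle_sq_le s₁ s₂ hξ h4 b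
      ((abs_repr_le_of_mem_tube hb h3 (by decide)).trans hle)
      ((abs_repr_le_of_mem_tube hb h3 (by decide)).trans hle)
  have hm : ∀ i, Measurable fun ξ => ENNReal.ofReal |g i ξ| := fun i =>
    (measurable_coneGrad s₁ s₂ b ξ₀ i).norm.ennreal_ofReal
  have hS : MeasurableSet T :=
    (measurableSet_coordBox b R).inter ((continuous_conePhase s₁ s₂ ξ₀).measurable hI)
  have hi : ∀ i, ∫⁻ ξ in T, ENNReal.ofReal |g i ξ| ≤ _ :=
    fun i => lintegral_coneGrad_le s₁ s₂ b ξ₀ i R hI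
  have i0 := hi 0
  have i1 := hi 1
  have i2 := hi 2
  have e0 : (∏ j : Fin 2, ENNReal.ofReal (2 * R ((0 : Fin 3).succAbove j))) =
      ENNReal.ofReal (4 * r ^ 2) := by
    rw [Fin.prod_univ_two, ← ENNReal.ofReal_mul (by simp [R, Fin.succAbove]; positivity)]
    congr 1; simp [R, Fin.succAbove]; ring
  have e1 : (∏ j : Fin 2, ENNReal.ofReal (2 * R ((1 : Fin 3).succAbove j))) =
      ENNReal.ofReal (4 * (N * r)) := by
    rw [Fin.prod_univ_two, ← ENNReal.ofReal_mul (by simp [R, Fin.succAbove]; positivity)]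
    congr 1; simp [R, Fin.succAbove]; ring
  have e2 : (∏ j : Fin 2, ENNReal.ofReal (2 * R ((2 : Fin 3).succAbove j))) =
      ENNReal.ofReal (4 * (N * r)) := by
    rw [Fin.prod_univ_two, ← ENNReal.ofReal_mul (by simp [R, Fin.succAbove]; positivity)]
    congr 1; simp [R, Fin.succAbove]; ring
  rw [e0] at i0
  rw [e1] at i1
  rw [e2] at i2
  have hmS : Measurable fun ξ => ENNReal.ofReal 5 * (ENNReal.ofReal |g 0 ξ| +
      ENNReal.ofReal (2 * r / N) * ENNReal.ofReal |g 1 ξ|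
        + ENNReal.ofReal (2 * r / N) * ENNReal.ofReal |g 2 ξ|) :=
    ((((hm 0).add ((hm 1).const_mul _))).add ((hm 2).const_mul _)).const_mul _
  calc _ ≤ ∫⁻ ξ in phaseSlab s₁ s₂ N r ω ξ₀ I,
        ENNReal.ofReal 5 * (ENNReal.ofReal |g 0 ξ| +
          ENNReal.ofReal (2 * r / N) * ENNReal.ofReal |g 1 ξ|
        + ENNReal.ofReal (2 * r / N) * ENNReal.ofReal |g 2 ξ|) := setLIntegral_mono hmS hpt
    _ ≤ ∫⁻ ξ in T, ENNReal.ofReal 5 * (ENNReal.ofReal |g 0 ξ| +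
          ENNReal.ofReal (2 * r / N) * ENNReal.ofReal |g 1 ξ|
        + ENNReal.ofReal (2 * r / N) * ENNReal.ofReal |g 2 ξ|) := lintegral_mono_set hsub
    _ = ENNReal.ofReal 5 * (∫⁻ ξ in T, ENNReal.ofReal |g 0 ξ|) + ENNReal.ofReal 5 *
          (ENNReal.ofReal (2 * r / N) * ∫⁻ ξ in T, ENNReal.ofReal |g 1 ξ|)
        + ENNReal.ofReal 5 *
          (ENNReal.ofReal (2 * r / N) * ∫⁻ ξ in T, ENNReal.ofReal |g 2 ξ|) := by
        have h1 : Measurable fun ξ => ENNReal.ofReal (2 * r / N) * ENNReal.ofReal |g 1 ξ| :=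
          (hm 1).const_mul _
        have h2 : Measurable fun ξ => ENNReal.ofReal (2 * r / N) * ENNReal.ofReal |g 2 ξ| :=
          (hm 2).const_mul _
        rw [lintegral_const_mul _ (by exact ((hm 0).add h1).add h2),
          lintegral_add_right _ h2, lintegral_add_right _ h1, lintegral_const_mul _ (hm 1), lintegral_const_mul _ (hm 2), mul_add, mul_add]
    _ ≤ ENNReal.ofReal 5 * (2 * volume I * ENNReal.ofReal (4 * r ^ 2)) + ENNReal.ofReal 5 *
          (ENNReal.ofReal (2 * r / N) * (2 * volume I * ENNReal.ofReal (4 * (N * r))))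
        + ENNReal.ofReal 5 *
          (ENNReal.ofReal (2 * r / N) * (2 * volume I * ENNReal.ofReal (4 * (N * r)))) := by
        gcongr
    _ = (ENNReal.ofReal 5 * ENNReal.ofReal 2 * ENNReal.ofReal (4 * r ^ 2) +
          ENNReal.ofReal 5 * ENNReal.ofReal (2 * r / N) * ENNReal.ofReal 2 *
            ENNReal.ofReal (4 * (N * r)) +
          ENNReal.ofReal 5 * ENNReal.ofReal (2 * r / N) * ENNReal.ofReal 2 *
            ENNReal.ofReal (4 * (N * r))) * volume I := by
        rw [ENNReal.ofReal_ofNat 2]; ring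
    -- The constant is `5·2·4 + 2·(5·2·2·4) = 200`.
    _ = _ := by
        congr 1
        simp only [← ENNReal.ofReal_mul (show (0 : ℝ) ≤ 5 by norm_num)]
        rw [← ENNReal.ofReal_mul (by positivity), ← ENNReal.ofReal_mul (by positivity),
          ← ENNReal.ofReal_mul (by positivity), ← ENNReal.ofReal_add (by positivity)
          (by positivity), ← ENNReal.ofReal_add (by positivity) (by positivity)]
        congr 1
        field_simp
        ring

/-- The set of `X₁` which contribute to the null form at `X₀`. -/
def interactionSet (s₁ s₂ : ℤˣ) (N₁ N₂ L₁ L₂ r : ℝ) (ω : Space3) (X₀ : SpaceTime) : Set SpaceTime :=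
  {X₁ | X₁ ∈ thickCone s₁ N₁ L₁ ∧ X₁ ∈ spaceTimeTube r ω ∧ X₀ - X₁ ∈ thickCone s₂ N₂ L₂}

theorem measurableSet_thickCone (s : ℤˣ) (N L : ℝ) : MeasurableSet (thickCone s N L) := by
  have h : Measurable fun X : SpaceTime => ‖X.snd‖ := Continuous.measurable (by fun_prop)
  have h' : Measurable fun X : SpaceTime => |-X.fst + signVal s * ‖X.snd‖| :=
    Continuous.measurable (by fun_prop)
  exact (measurableSet_lt measurable_const h).inter
    ((measurableSet_le h measurable_const).inter (measurableSet_le h' measurable_const))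

theorem measurableSet_interactionSet (s₁ s₂ : ℤˣ) (N₁ N₂ L₁ L₂ r : ℝ) (ω : Space3)
    (X₀ : SpaceTime) : MeasurableSet (interactionSet s₁ s₂ N₁ N₂ L₁ L₂ r ω X₀) := by
  have h : Measurable fun X₁ : SpaceTime => X₀ - X₁ := Continuous.measurable (by fun_prop)
  exact (measurableSet_thickCone s₁ N₁ L₁).inter ((measurableSet_spaceTimeTube r ω).inter
    (h (measurableSet_thickCone s₂ N₂ L₂)))

theorem theta12_nonneg (s₁ s₂ : ℤˣ) (X₁ X₂ : SpaceTime) : 0 ≤ theta12 s₁ s₂ X₁ X₂ :=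
  InnerProductGeometry.angle_nonneg _ _

theorem measurable_theta12 (s₁ s₂ : ℤˣ) :
    Measurable fun p : SpaceTime × SpaceTime => theta12 s₁ s₂ p.2 (p.1 - p.2) := by
  unfold theta12 InnerProductGeometry.angle
  refine Real.measurable_arccos.comp (Measurable.div ?_ ?_) <;>
  exact Continuous.measurable (by fun_prop)

/-- Fubini in `(τ, ξ)`: the two modulation constraints bound the `τ`-fibre by the smaller of `L₁`,
`L₂`, and their sum restricts the phase to an interval governed by the larger. -/
theorem lintegral_theta12_sq_le (s₁ s₂ : ℤˣ) {N₁ N₂ L₁ L₂ r : ℝ} {ω : Space3} (hN₁ : 0 < N₁)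
    (hN₂ : 0 < N₂) (hL₁ : 0 < L₁) (hL₂ : 0 < L₂) (hr : 0 < r) (hω : ‖ω‖ = 1) (X₀ : SpaceTime) :
    ∫⁻ X₁ in interactionSet s₁ s₂ N₁ N₂ L₁ L₂ r ω X₀,
      ENNReal.ofReal (theta12 s₁ s₂ X₁ (X₀ - X₁) ^ 2) ≤ ENNReal.ofReal (1600 * (r ^ 2 * L₁ * L₂)) := by
  have hE := measurableSet_interactionSet s₁ s₂ N₁ N₂ L₁ L₂ r ω X₀
  have hθ : Measurable fun X₁ => ENNReal.ofReal (theta12 s₁ s₂ X₁ (X₀ - X₁) ^ 2) :=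
    (((measurable_theta12 s₁ s₂).comp (measurable_const.prodMk measurable_id)).pow_const
      2).ennreal_ofReal
  have hF := hθ.indicator hE
  rw [← lintegral_indicator hE, ← (WithLp.volume_preserving_toLp ℝ Space3).lintegral_comp hF]
  have hprod := lintegral_prod_symm' (μ := (volume : Measure ℝ)) (ν := (volume : Measure Space3)) _
    (hF.comp (WithLp.volume_preserving_toLp ℝ Space3).measurable)
  refine hprod.trans_le ?_
  -- Adding the two modulation inequalities cancels `τ` and leaves this range for the phase.
  set I := Icc (X₀.fst - (L₁ + L₂)) (X₀.fst + (L₁ + L₂))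
  set S := phaseSlab s₁ s₂ N₁ r ω X₀.snd I
  have hI : MeasurableSet I := measurableSet_Icc
  have hS : MeasurableSet S := by
    have h0 : MeasurableSet {ξ : Space3 | X₀.snd - ξ ≠ 0} :=
      ((measurable_const.sub measurable_id) (measurableSet_singleton (0 : Space3))).compl
    have h1 : MeasurableSet (tube r ω) :=
      (isClosed_le (Metric.continuous_infDist_pt _) continuous_const).measurableSet
    exact (measurableSet_lt measurable_const measurable_norm).inter
      ((measurableSet_le measurable_norm measurable_const).inter (h1.inter
        (h0.inter ((continuous_conePhase s₁ s₂ X₀.snd).measurable hI))))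
  set A : Space3 → ENNReal := fun ξ => ENNReal.ofReal
    (InnerProductGeometry.angle (signVal s₁ • ξ) (signVal s₂ • (X₀.snd - ξ)) ^ 2)
  set m := min L₁ L₂
  have inner : ∀ ξ : Space3, ∫⁻ τ : ℝ, (interactionSet s₁ s₂ N₁ N₂ L₁ L₂ r ω X₀).indicator
      (fun X₁ => ENNReal.ofReal (theta12 s₁ s₂ X₁ (X₀ - X₁) ^ 2)) (WithLp.toLp 2 (τ, ξ)) ≤
      ENNReal.ofReal (2 * m) * S.indicator A ξ := by
    intro ξ
    set J : Set ℝ := Icc (signVal s₁ * ‖ξ‖ - L₁) (signVal s₁ * ‖ξ‖ + L₁) ∩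
      Icc (X₀.fst - signVal s₂ * ‖X₀.snd - ξ‖ - L₂) (X₀.fst - signVal s₂ * ‖X₀.snd - ξ‖ + L₂)
    have hJ : volume J ≤ ENNReal.ofReal (2 * m) := by
      rcases le_total L₁ L₂ with h | h
      · refine (measure_mono inter_subset_left).trans ?_
        rw [Real.volume_Icc]
        exact ENNReal.ofReal_le_ofReal (by simp only [m, min_eq_left h]; linarith)
      · refine (measure_mono inter_subset_right).trans ?_
        rw [Real.volume_Icc]
        exact ENNReal.ofReal_le_ofReal (by simp only [m, min_eq_right h]; linarith)
    calc _ ≤ ∫⁻ τ : ℝ, J.indicator (fun _ => S.indicator A ξ) τ := by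
          refine lintegral_mono fun τ => ?_
          by_cases h : (WithLp.toLp 2 (τ, ξ) : SpaceTime) ∈
              interactionSet s₁ s₂ N₁ N₂ L₁ L₂ r ω X₀
          · rw [indicator_of_mem h]
            obtain ⟨⟨h1, h2, h3⟩, h4, h5, -, h7⟩ := h
            rw [abs_le] at h3 h7
            simp only [WithLp.sub_snd, WithLp.sub_fst] at h5 h7
            change N₁ / 2 < ‖ξ‖ at h1
            change ‖ξ‖ ≤ N₁ at h2
            change -L₁ ≤ -τ + signVal s₁ * ‖ξ‖ ∧ -τ + signVal s₁ * ‖ξ‖ ≤ L₁ at h3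
            change N₂ / 2 < ‖X₀.snd - ξ‖ at h5
            change -L₂ ≤ -(X₀.fst - τ) + signVal s₂ * ‖X₀.snd - ξ‖ ∧
              -(X₀.fst - τ) + signVal s₂ * ‖X₀.snd - ξ‖ ≤ L₂ at h7
            have hS' : ξ ∈ S := by
              refine ⟨h1, h2, h4, norm_pos_iff.1 (by linarith), ?_⟩
              constructor <;> simp only [conePhase] <;> linarith
            have hJ' : τ ∈ J := ⟨⟨by linarith, by linarith⟩, ⟨by linarith, by linarith⟩⟩
            rw [indicator_of_mem hJ', indicator_of_mem hS']
            rfl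
          · rw [indicator_of_notMem h]
            exact zero_le
      _ = S.indicator A ξ * volume J := by
          rw [lintegral_indicator (measurableSet_Icc.inter measurableSet_Icc), setLIntegral_const]
      _ ≤ _ := by rw [mul_comm]; gcongr
  calc _ ≤ ∫⁻ ξ, ENNReal.ofReal (2 * m) * S.indicator A ξ := lintegral_mono inner
    _ = ENNReal.ofReal (2 * m) * ∫⁻ ξ in S, A ξ := by
        rw [lintegral_const_mul' _ _ ENNReal.ofReal_ne_top, lintegral_indicator hS]
    _ ≤ ENNReal.ofReal (2 * m) * (ENNReal.ofReal (200 * r ^ 2) * volume I) := by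
        gcongr
        exact lintegral_angle_sq_le s₁ s₂ hN₁ hr hω X₀.snd hI
    _ ≤ _ := by
        have hm : 0 < m := lt_min hL₁ hL₂
        rw [Real.volume_Icc, ← ENNReal.ofReal_mul (by positivity),
          ← ENNReal.ofReal_mul (by positivity)]
        refine ENNReal.ofReal_le_ofReal ?_
        -- With `m = min L₁ L₂`, the total is `2m · 200 r² · 2(L₁ + L₂) = 800 r² m (L₁ + L₂)`, hence
        -- 1600.
        have h1 : m * (L₁ + L₂) ≤ 2 * (L₁ * L₂) := by
          have := min_le_left L₁ L₂
          have := min_le_right L₁ L₂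
          nlinarith
        have h2 := mul_le_mul_of_nonneg_left h1 (sq_nonneg r)
        nlinarith

/-! ### Cauchy–Schwarz and the bilinear estimate for functions of frequency -/

theorem sq_lintegral_mul_le {α : Type*} [MeasurableSpace α] (μ : Measure α) {f g : α → ENNReal}
    (hf : AEMeasurable f μ) (hg : AEMeasurable g μ) :
    (∫⁻ x, f x * g x ∂μ) ^ 2 ≤ (∫⁻ x, f x ^ 2 ∂μ) * ∫⁻ x, g x ^ 2 ∂μ := by
  have h := ENNReal.lintegral_mul_le_Lp_mul_Lq μ Real.HolderConjugate.two_two hf hg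
  simp only [Pi.mul_apply, ENNReal.rpow_ofNat] at h
  calc _ ≤ _ := pow_le_pow_left₀ zero_le h 2
    _ = _ := by
      rw [mul_pow, ← ENNReal.rpow_mul_natCast, ← ENNReal.rpow_mul_natCast]
      norm_num

/-- The bilinear estimate on the Fourier side. -/
theorem lintegral_sq_nullForm_le (s₁ s₂ : ℤˣ) {N₁ N₂ L₁ L₂ r : ℝ} {ω : Space3} (hN₁ : 0 < N₁)
    (hN₂ : 0 < N₂) (hL₁ : 0 < L₁) (hL₂ : 0 < L₂) (hr : 0 < r) (hω : ‖ω‖ = 1)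
    {f g : SpaceTime → ℂ} (hf : Measurable f) (hg : Measurable g)
    (hfK : ∀ᵐ X, X ∉ thickCone s₁ N₁ L₁ ∩ spaceTimeTube r ω → f X = 0)
    (hgK : ∀ᵐ X, X ∉ thickCone s₂ N₂ L₂ → g X = 0) :
    ∫⁻ X₀, (∫⁻ X₁, ‖(theta12 s₁ s₂ X₁ (X₀ - X₁) : ℂ) * f X₁ * g (X₀ - X₁)‖ₑ) ^ 2 ≤
      ENNReal.ofReal (1600 * (r ^ 2 * L₁ * L₂)) * ((∫⁻ X, ‖f X‖ₑ ^ 2) * ∫⁻ X, ‖g X‖ₑ ^ 2) := by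
  have hsub : ∀ X₀ : SpaceTime, MeasurePreserving (fun X₁ => X₀ - X₁) volume volume := fun X₀ =>
    Measure.measurePreserving_sub_left volume X₀
  have hpt : ∀ X₀, (∫⁻ X₁, ‖(theta12 s₁ s₂ X₁ (X₀ - X₁) : ℂ) * f X₁ * g (X₀ - X₁)‖ₑ) ^ 2 ≤
      ENNReal.ofReal (1600 * (r ^ 2 * L₁ * L₂)) *
        ∫⁻ X₁, ‖f X₁‖ₑ ^ 2 * ‖g (X₀ - X₁)‖ₑ ^ 2 := by
    intro X₀
    set E := interactionSet s₁ s₂ N₁ N₂ L₁ L₂ r ω X₀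
    have hE : MeasurableSet E := measurableSet_interactionSet s₁ s₂ N₁ N₂ L₁ L₂ r ω X₀
    have hθ : Measurable fun X₁ => ENNReal.ofReal (theta12 s₁ s₂ X₁ (X₀ - X₁)) :=
      ((measurable_theta12 s₁ s₂).comp (measurable_const.prodMk measurable_id)).ennreal_ofReal
    have hfg : Measurable fun X₁ => ‖f X₁‖ₑ * ‖g (X₀ - X₁)‖ₑ :=
      hf.enorm.mul (hg.comp (hsub X₀).measurable).enorm
    -- The support conditions allow the cutoff to be placed on `θ₁₂`, so that Cauchy–Schwarz
    -- separates it from the data.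
    have heq : ∫⁻ X₁, ‖(theta12 s₁ s₂ X₁ (X₀ - X₁) : ℂ) * f X₁ * g (X₀ - X₁)‖ₑ =
        ∫⁻ X₁, E.indicator (fun X₁ => ENNReal.ofReal (theta12 s₁ s₂ X₁ (X₀ - X₁))) X₁ *
          (‖f X₁‖ₑ * ‖g (X₀ - X₁)‖ₑ) := by
      refine lintegral_congr_ae ?_
      filter_upwards [hfK, (hsub X₀).quasiMeasurePreserving.ae hgK] with X₁ h1 h2
      by_cases h : X₁ ∈ E
      · rw [indicator_of_mem h, enorm_mul, enorm_mul, mul_assoc]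
        congr 1
        rw [← ofReal_norm, Complex.norm_real, Real.norm_eq_abs,
          abs_of_nonneg (theta12_nonneg _ _ _ _)]
      · rw [indicator_of_notMem h, zero_mul]
        by_cases hx : X₁ ∈ thickCone s₁ N₁ L₁ ∩ spaceTimeTube r ω
        · rw [h2 fun h3 => h ⟨hx.1, hx.2, h3⟩]; simp
        · rw [h1 hx]; simp
    rw [heq]
    refine (sq_lintegral_mul_le volume (hθ.indicator hE).aemeasurable
      hfg.aemeasurable).trans ?_
    refine mul_le_mul' ?_ (le_of_eq ?_)
    · refine le_trans (le_of_eq ?_) (lintegral_theta12_sq_le s₁ s₂ hN₁ hN₂ hL₁ hL₂ hr hω X₀)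
      rw [← lintegral_indicator hE]
      congr 1 with X₁
      by_cases h : X₁ ∈ E
      · rw [indicator_of_mem h, indicator_of_mem h,
          ENNReal.ofReal_pow (theta12_nonneg _ _ _ _)]
      · rw [indicator_of_notMem h, indicator_of_notMem h]; simp
    · simp_rw [mul_pow]
  have hmeas : Measurable fun p : SpaceTime × SpaceTime => ‖f p.2‖ₑ ^ 2 * ‖g (p.1 - p.2)‖ₑ ^ 2 :=
    ((hf.comp measurable_snd).enorm.pow_const 2).mul
      ((hg.comp (measurable_fst.sub measurable_snd)).enorm.pow_const 2)
  calc _ ≤ ∫⁻ X₀, ENNReal.ofReal (1600 * (r ^ 2 * L₁ * L₂)) *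
        ∫⁻ X₁, ‖f X₁‖ₑ ^ 2 * ‖g (X₀ - X₁)‖ₑ ^ 2 := lintegral_mono hpt
    _ = ENNReal.ofReal (1600 * (r ^ 2 * L₁ * L₂)) *
        ∫⁻ X₀, ∫⁻ X₁, ‖f X₁‖ₑ ^ 2 * ‖g (X₀ - X₁)‖ₑ ^ 2 :=
        lintegral_const_mul' _ _ ENNReal.ofReal_ne_top
    _ = _ := by
        congr 1
        -- By Tonelli and translation invariance, the convolution of the squares has integral equal
        -- to the product of the integrals.
        rw [lintegral_lintegral_swap hmeas.aemeasurable]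
        have : ∀ X₁, ∫⁻ X₀, ‖f X₁‖ₑ ^ 2 * ‖g (X₀ - X₁)‖ₑ ^ 2 =
            ‖f X₁‖ₑ ^ 2 * ∫⁻ X, ‖g X‖ₑ ^ 2 := fun X₁ => by
          rw [lintegral_const_mul' _ _ (by simp)]
          congr 1
          exact lintegral_sub_right_eq_self (fun X => ‖g X‖ₑ ^ 2) X₁
        simp_rw [this]
        rw [lintegral_mul_const _ (hf.enorm.pow_const 2)]

/-! ### Plancherel and transfer to `L²` -/

theorem measurable_fourierHat (u : L2SpaceTime) : Measurable (fourierHat u) :=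
  (Lp.stronglyMeasurable _).measurable.comp (measurable_const_smul _)

theorem ae_smul {P : SpaceTime → Prop} (h : ∀ᵐ X, P X) {c : ℝ} (hc : c ≠ 0) : ∀ᵐ X, P (c • X) :=
  (Measure.quasiMeasurePreserving_smul volume hc).ae h

theorem lintegral_comp_inv_smul {F : SpaceTime → ENNReal} (hF : Measurable F) {c : ℝ}
    (hc : 0 < c) : ∫⁻ X, F (c⁻¹ • X) = ENNReal.ofReal (c ^ 4) * ∫⁻ X, F X := by
  have h4 : Module.finrank ℝ SpaceTime = 4 := by
    rw [(WithLp.linearEquiv 2 ℝ (ℝ × Space3)).finrank_eq]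
    simp
  rw [← lintegral_map hF (measurable_const_smul c⁻¹),
    Measure.map_addHaar_smul volume (inv_ne_zero hc.ne'), h4, lintegral_smul_measure, inv_pow,
    inv_inv, abs_of_pos (by positivity), smul_eq_mul]

theorem enorm_sq_eq_lintegral (u : L2SpaceTime) : ‖u‖ₑ ^ 2 = ∫⁻ X, ‖u X‖ₑ ^ 2 := by
  rw [Lp.enorm_def, eLpNorm_eq_lintegral_rpow_enorm_toReal (by simp) (by simp),
    ← ENNReal.rpow_natCast, ← ENNReal.rpow_mul]
  simp

/-- Plancherel for the kernel `e^{-ix·X}`: the factor is the Jacobian of the dilation by `2π` in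
dimension 4. -/
theorem lintegral_enorm_sq_fourierHat (u : L2SpaceTime) :
    ∫⁻ X, ‖fourierHat u X‖ₑ ^ 2 = ENNReal.ofReal ((2 * Real.pi) ^ 4) * ‖u‖ₑ ^ 2 := by
  have h1 : ‖u‖ₑ = ‖(𝓕 u : L2SpaceTime)‖ₑ := by
    rw [← ofReal_norm, ← ofReal_norm, Lp.norm_fourier_eq]
  rw [h1, enorm_sq_eq_lintegral]
  exact lintegral_comp_inv_smul (F := fun X => ‖(𝓕 u : L2SpaceTime) X‖ₑ ^ 2)
    ((Lp.stronglyMeasurable _).measurable.enorm.pow_const 2) (by positivity)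

theorem lintegral_enorm_sq_of_fourierHat_eq {u : L2SpaceTime} {g : SpaceTime → ℂ}
    (h : fourierHat u =ᵐ[volume] g) :
    ∫⁻ X, ‖g X‖ₑ ^ 2 = ENNReal.ofReal ((2 * Real.pi) ^ 4) * ‖u‖ₑ ^ 2 := by
  rw [← lintegral_enorm_sq_fourierHat]
  refine lintegral_congr_ae ?_
  filter_upwards [h] with X hX
  rw [hX]

/-- Every square integrable function is the Fourier transform of an element of `L²`. -/
theorem exists_fourierHat_eq {g : SpaceTime → ℂ} (hg : Measurable g)
    (hfin : ∫⁻ X, ‖g X‖ₑ ^ 2 < ⊤) : ∃ b : L2SpaceTime, fourierHat b =ᵐ[volume] g := by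
  have hpi : 0 < 2 * Real.pi := by positivity
  have hint : ∫⁻ X, ‖g ((2 * Real.pi) • X)‖ₑ ^ 2 < ⊤ := by
    have := lintegral_comp_inv_smul (hg.enorm.pow_const 2) (inv_pos.2 hpi)
    rw [inv_inv] at this
    rw [this]
    exact ENNReal.mul_lt_top ENNReal.ofReal_lt_top hfin
  have hmem : MemLp (fun X => g ((2 * Real.pi) • X)) 2 (volume : Measure SpaceTime) := by
    refine ⟨(hg.comp (measurable_const_smul _)).aestronglyMeasurable, ?_⟩
    rw [eLpNorm_eq_lintegral_rpow_enorm_toReal (by simp) (by simp)]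
    refine ENNReal.rpow_lt_top_of_nonneg (by positivity) ?_
    simpa using hint.ne
  refine ⟨𝓕⁻ hmem.toLp, ?_⟩
  have h := ae_smul hmem.coeFn_toLp (inv_ne_zero hpi.ne')
  filter_upwards [h] with X hX
  rw [fourierHat, FourierTransform.fourier_fourierInv_eq, hX, smul_smul,
    mul_inv_cancel₀ hpi.ne', one_smul]

theorem fourierHat_fourierProj {A : Set SpaceTime} (hA : MeasurableSet A) (u : L2SpaceTime) :
    fourierHat (fourierProj hA u) =ᵐ[volume] A.indicator (fourierHat u) := by
  have hpi : 0 < 2 * Real.pi := by positivity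
  have h := ae_smul ((Lp.memLp (𝓕 u : L2SpaceTime)).indicator
    (measurableSet_dilate hA)).coeFn_toLp (inv_ne_zero hpi.ne')
  filter_upwards [h] with X hX
  rw [fourierHat, fourierProj, FourierTransform.fourier_fourierInv_eq, cutoff, hX]
  by_cases hXA : X ∈ A
  · rw [indicator_of_mem hXA, indicator_of_mem]
    · rfl
    · rwa [mem_preimage, smul_smul, mul_inv_cancel₀ hpi.ne', one_smul]
  · rw [indicator_of_notMem hXA, indicator_of_notMem]
    rwa [mem_preimage, smul_smul, mul_inv_cancel₀ hpi.ne', one_smul]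

/-- The null form with a tube restriction is well defined and bounded on `L²`. -/
theorem exists_isNullForm_norm_le (s₁ s₂ : ℤˣ) {N₁ N₂ L₁ L₂ r : ℝ} {ω : Space3}
    {u₁ u₂ : L2SpaceTime} (hN₁ : 0 < N₁) (hN₂ : 0 < N₂) (hL₁ : 0 < L₁) (hL₂ : 0 < L₂) (hr : 0 < r)
    (hω : ‖ω‖ = 1) (h₁ : FourierSupportedIn u₁ (thickCone s₁ N₁ L₁))
    (h₂ : FourierSupportedIn u₂ (thickCone s₂ N₂ L₂)) :
    ∃ b : L2SpaceTime,
      IsNullForm s₁ s₂ (fourierProj (measurableSet_spaceTimeTube r ω) u₁) u₂ b ∧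
      ‖b‖ ≤ 40 * (2 * Real.pi) ^ 2 * Real.sqrt (r ^ 2 * L₁ * L₂) * ‖u₁‖ * ‖u₂‖ := by
  set v := fourierProj (measurableSet_spaceTimeTube r ω) u₁
  have hv := fourierHat_fourierProj (measurableSet_spaceTimeTube r ω) u₁
  have hfK : ∀ᵐ X, X ∉ thickCone s₁ N₁ L₁ ∩ spaceTimeTube r ω → fourierHat v X = 0 := by
    filter_upwards [hv, h₁] with X hX h1 hnot
    rw [hX]
    by_cases hT : X ∈ spaceTimeTube r ω
    · rw [indicator_of_mem hT, h1 fun h => hnot ⟨h, hT⟩]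
    · rw [indicator_of_notMem hT]
  have hvle : ∫⁻ X, ‖fourierHat v X‖ₑ ^ 2 ≤ ENNReal.ofReal ((2 * Real.pi) ^ 4) * ‖u₁‖ₑ ^ 2 := by
    rw [← lintegral_enorm_sq_fourierHat]
    refine lintegral_mono_ae ?_
    filter_upwards [hv] with X hX
    rw [hX]
    gcongr
    exact enorm_indicator_le_enorm_self _ _
  have hmain := lintegral_sq_nullForm_le s₁ s₂ hN₁ hN₂ hL₁ hL₂ hr hω (measurable_fourierHat v)
    (measurable_fourierHat u₂) hfK h₂
  rw [lintegral_enorm_sq_fourierHat u₂] at hmain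
  have hbound := hmain.trans (mul_le_mul_right (mul_le_mul_left hvle _) _)
  have hjoint : Measurable fun p : SpaceTime × SpaceTime => nullFormIntegrand s₁ s₂ v u₂ p.1 p.2 :=
    ((Complex.measurable_ofReal.comp (measurable_theta12 s₁ s₂)).mul
      ((measurable_fourierHat v).comp measurable_snd)).mul
      ((measurable_fourierHat u₂).comp (measurable_fst.sub measurable_snd))
  set K : SpaceTime → ENNReal := fun X₀ => ∫⁻ X₁, ‖nullFormIntegrand s₁ s₂ v u₂ X₀ X₁‖ₑ
  have hKmeas : Measurable K := hjoint.enorm.lintegral_prod_right'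
  have hKle : ∫⁻ X₀, K X₀ ^ 2 ≤ _ := hbound
  have hfin : ∫⁻ X₀, K X₀ ^ 2 < ⊤ := by
    refine hKle.trans_lt (ENNReal.mul_lt_top ENNReal.ofReal_lt_top (ENNReal.mul_lt_top ?_ ?_)) <;>
    exact ENNReal.mul_lt_top ENNReal.ofReal_lt_top (by simp)
  set G : SpaceTime → ℂ := fun X₀ => ∫ X₁, nullFormIntegrand s₁ s₂ v u₂ X₀ X₁
  have hGmeas : Measurable G := (hjoint.stronglyMeasurable.integral_prod_right').measurable
  have hGK : ∫⁻ X₀, ‖G X₀‖ₑ ^ 2 ≤ ∫⁻ X₀, K X₀ ^ 2 := by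
    refine lintegral_mono fun X₀ => ?_
    gcongr
    exact enorm_integral_le_lintegral_enorm _
  obtain ⟨b, hb⟩ := exists_fourierHat_eq hGmeas (hGK.trans_lt hfin)
  refine ⟨b, ?_, ?_⟩
  -- Square integrability of `K` makes it finite almost everywhere, which is the absolute
  -- convergence of the defining integral.
  · filter_upwards [hb, ae_lt_top (hKmeas.pow_const 2) hfin.ne] with X₀ hX hK
    refine ⟨⟨(hjoint.comp measurable_prodMk_left).aestronglyMeasurable, ?_⟩, hX⟩
    by_contra h
    rw [HasFiniteIntegral, not_lt, top_le_iff] at h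
    have : K X₀ = ⊤ := h
    simp [this] at hK
  · have h1 := hGK.trans hKle
    rw [lintegral_enorm_sq_of_fourierHat_eq hb] at h1
    simp only [← ofReal_norm] at h1
    rw [← ENNReal.ofReal_pow (norm_nonneg _), ← ENNReal.ofReal_pow (norm_nonneg _),
      ← ENNReal.ofReal_pow (norm_nonneg _), ← ENNReal.ofReal_mul (by positivity),
      ← ENNReal.ofReal_mul (by positivity), ← ENNReal.ofReal_mul (by positivity),
      ← ENNReal.ofReal_mul (by positivity), ← ENNReal.ofReal_mul (by positivity),
      ENNReal.ofReal_le_ofReal_iff (by positivity)] at h1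
    refine le_of_sq_le_sq ?_ (by positivity)
    -- Two Plancherel factors `(2π)⁴` on the right against one on the left leave `(2π)²` after the
    -- square root; `40² = 1600`.
    have h2 : Real.sqrt (r ^ 2 * L₁ * L₂) ^ 2 = r ^ 2 * L₁ * L₂ := Real.sq_sqrt (by positivity)
    have h3 : 0 < (2 * Real.pi) ^ 4 := by positivity
    refine le_of_mul_le_mul_left (h1.trans (le_of_eq ?_)) h3
    simp only [mul_pow, h2]
    ring

/-! ### The Knapp example -/

/-- A box around the origin which is thin in the direction transversal to the cone along `b 0`. -/
def knappBox (b : OrthonormalBasis (Fin 3) ℝ Space3) (L N r : ℝ) : Set SpaceTime :=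
  {X | |X.fst - b.repr X.snd 0| ≤ L / 2 ∧ X.snd ∈ coordBox b ![N / 16, r / 16, r / 16]}

theorem toLp_mem_knappBox {b : OrthonormalBasis (Fin 3) ℝ Space3} {L N r τ : ℝ} {ξ : Space3} :
    WithLp.toLp 2 (τ, ξ) ∈ knappBox b L N r ↔
      |τ - b.repr ξ 0| ≤ L / 2 ∧ ξ ∈ coordBox b ![N / 16, r / 16, r / 16] :=
  Iff.rfl

theorem measurableSet_knappBox (b : OrthonormalBasis (Fin 3) ℝ Space3) (L N r : ℝ) :
    MeasurableSet (knappBox b L N r) := by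
  have h : Measurable fun X : SpaceTime => |X.fst - b.repr X.snd 0| :=
    Continuous.measurable (by fun_prop)
  have h' : Measurable fun X : SpaceTime => X.snd := Continuous.measurable (by fun_prop)
  exact (measurableSet_le h measurable_const).inter (h' (measurableSet_coordBox b _))

theorem volume_coordBox (b : OrthonormalBasis (Fin 3) ℝ Space3) (R : Fin 3 → ℝ) :
    volume (coordBox b R) = ∏ j, ENNReal.ofReal (2 * R j) := by
  have hm := (PiLp.volume_preserving_ofLp (Fin 3)).comp b.measurePreserving_repr
  have heq : coordBox b R = (WithLp.ofLp ∘ b.repr) ⁻¹' Icc (fun j => -R j) R := by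
    ext ξ
    simp only [coordBox, mem_ofPred_eq, abs_le, mem_preimage, mem_Icc, Pi.le_def,
      Function.comp_apply, forall_and]
  rw [heq, hm.measure_preimage measurableSet_Icc.nullMeasurableSet, Real.volume_Icc_pi]
  congr 1 with j
  ring_nf

theorem volume_knappBox (b : OrthonormalBasis (Fin 3) ℝ Space3) {L N r : ℝ} (hL : 0 < L)
    (hN : 0 < N) (hr : 0 < r) :
    volume (knappBox b L N r) = ENNReal.ofReal (L * N * r ^ 2 / 512) := by
  have hQ := measurableSet_knappBox b L N r
  have hm := WithLp.volume_preserving_toLp ℝ Space3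
  rw [← hm.measure_preimage hQ.nullMeasurableSet]
  have hprod := Measure.prod_apply_symm (μ := (volume : Measure ℝ))
    (ν := (volume : Measure Space3)) (hm.measurable hQ)
  refine hprod.trans ?_
  have hslice : ∀ ξ : Space3, volume ((fun τ : ℝ => (τ, ξ)) ⁻¹'
      (WithLp.toLp 2 ⁻¹' knappBox b L N r)) =
      (coordBox b ![N / 16, r / 16, r / 16]).indicator (fun _ => ENNReal.ofReal L) ξ := by
    intro ξ
    by_cases hξ : ξ ∈ coordBox b ![N / 16, r / 16, r / 16]
    · rw [indicator_of_mem hξ]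
      have : (fun τ : ℝ => (τ, ξ)) ⁻¹' (WithLp.toLp 2 ⁻¹' knappBox b L N r) =
          Icc (b.repr ξ 0 - L / 2) (b.repr ξ 0 + L / 2) := by
        ext τ
        simp only [mem_preimage, toLp_mem_knappBox, hξ, and_true, abs_le, mem_Icc]
        constructor <;> rintro ⟨h1, h2⟩ <;> constructor <;> linarith
      rw [this, Real.volume_Icc]
      congr 1; ring
    · rw [indicator_of_notMem hξ]
      have : (fun τ : ℝ => (τ, ξ)) ⁻¹' (WithLp.toLp 2 ⁻¹' knappBox b L N r) = ∅ := by
        ext τ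
        simp [toLp_mem_knappBox, hξ]
      rw [this, measure_empty]
  simp_rw [hslice]
  rw [lintegral_indicator (measurableSet_coordBox b _), setLIntegral_const, volume_coordBox,
    Fin.prod_univ_three]
  simp only [Matrix.cons_val_zero, Matrix.cons_val_one, Matrix.cons_val]
  rw [← ENNReal.ofReal_mul (by positivity), ← ENNReal.ofReal_mul (by positivity),
    ← ENNReal.ofReal_mul (by positivity)]
  congr 1; ring

/-- The box is convex and symmetric, and `X - Y` is the midpoint of `2X` and `-2Y`. Half-sized
copies therefore give a full set of admissible `X₁` for every `X₀` in a set of comparable size. -/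
theorem mem_knappBox_of_two_smul {b : OrthonormalBasis (Fin 3) ℝ Space3} {L N r : ℝ}
    {X Y : SpaceTime} (hX : (2 : ℝ) • X ∈ knappBox b L N r) (hY : (2 : ℝ) • Y ∈ knappBox b L N r) :
    X - Y ∈ knappBox b L N r := by
  obtain ⟨hX1, hX2⟩ := hX
  obtain ⟨hY1, hY2⟩ := hY
  simp only [WithLp.smul_fst, WithLp.smul_snd, map_smul, PiLp.smul_apply, smul_eq_mul,
    abs_le, coordBox, mem_ofPred_eq] at hX1 hX2 hY1 hY2
  refine ⟨?_, fun j => ?_⟩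
  · simp only [WithLp.sub_fst, WithLp.sub_snd, map_sub, PiLp.sub_apply]
    rw [abs_le]
    constructor <;> linarith
  · simp only [WithLp.sub_snd, map_sub, PiLp.sub_apply]
    have := hX2 j
    have := hY2 j
    rw [abs_le]
    constructor <;> linarith

theorem mem_knappBox_of_two_smul_self {b : OrthonormalBasis (Fin 3) ℝ Space3} {L N r : ℝ}
    {X : SpaceTime} (hX : (2 : ℝ) • X ∈ knappBox b L N r) : X ∈ knappBox b L N r := by
  obtain ⟨h1, h2⟩ := hX
  have h0 : (2 : ℝ) • (0 : SpaceTime) ∈ knappBox b L N r := by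
    refine ⟨?_, fun j => ?_⟩
    · simpa using (abs_nonneg _).trans h1
    · simpa using (abs_nonneg _).trans (h2 j)
  simpa using mem_knappBox_of_two_smul ⟨h1, h2⟩ h0

/-- The center of a translated box which lies in the thickened cone with sign `s`. -/
noncomputable def knappCenter (b : OrthonormalBasis (Fin 3) ℝ Space3) (N r : ℝ) (s : ℤˣ) (κ : ℝ) :
    SpaceTime :=
  WithLp.toLp 2 (signVal s * (11 / 16 * N),
    b.repr.symm !₂[signVal s * (11 / 16 * N), signVal s * (κ * (3 / 16 * r)), 0])

theorem knappCenter_fst (b : OrthonormalBasis (Fin 3) ℝ Space3) (N r : ℝ) (s : ℤˣ) (κ : ℝ) :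
    (knappCenter b N r s κ).fst = signVal s * (11 / 16 * N) :=
  rfl

theorem repr_knappCenter_snd (b : OrthonormalBasis (Fin 3) ℝ Space3) (N r : ℝ) (s : ℤˣ) (κ : ℝ) :
    b.repr (knappCenter b N r s κ).snd =
      !₂[signVal s * (11 / 16 * N), signVal s * (κ * (3 / 16 * r)), 0] :=
  b.repr.apply_symm_apply _

/-- The box lies within `L/2` of the hyperplane where `τ` equals the axial coordinate. The cone
leaves that hyperplane by `|ξ| - y = (z² + x₂²)/(|ξ| + y)`, of order `r²/N = L`, where `y` is the
axial and `z`, `x₂` are the transversal coordinates up to sign. The last conclusion fixes the side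
of the axis, for the angle. -/
theorem mem_thickCone_of_sub_mem_knappBox {b : OrthonormalBasis (Fin 3) ℝ Space3} {ω : Space3}
    (hb : b 0 = ω) {L N r κ : ℝ} (hL : 0 < L) (hLN : L ≤ N) (hr : 0 < r) (hrN : r ^ 2 = N * L)
    (s : ℤˣ) (hκ : κ = 1 ∨ κ = -1) {X : SpaceTime}
    (hX : X - knappCenter b N r s κ ∈ knappBox b L N r) :
    X ∈ thickCone s N L ∧ X ∈ spaceTimeTube r ω ∧ r / 8 ≤ κ * (signVal s * b.repr X.snd 1) := by
  have hN : 0 < N := hL.trans_le hLN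
  obtain ⟨h, h'⟩ := hX
  have h0 := h' 0
  have h1 := h' 1
  have h2 := h' 2
  simp only [WithLp.sub_fst, WithLp.sub_snd, map_sub, PiLp.sub_apply, knappCenter_fst,
    repr_knappCenter_snd, Matrix.cons_val_zero, Matrix.cons_val_one,
    Matrix.cons_val, sub_zero] at h h0 h1 h2
  have hn := norm_sq_eq_sum_repr b X.snd
  have hnn := norm_nonneg X.snd
  have hx0 := abs_repr_le_norm b X.snd 0
  have htube : b.repr X.snd 1 ^ 2 + b.repr X.snd 2 ^ 2 ≤ r ^ 2 → X ∈ spaceTimeTube r ω :=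
    fun hle => mem_tube_of_sq_le hb hr.le hle
  simp only [thickCone, mem_ofPred_eq]
  generalize ‖X.snd‖ = n at *
  generalize b.repr X.snd 0 = x0 at *
  generalize b.repr X.snd 1 = x1 at *
  generalize b.repr X.snd 2 = x2 at *
  generalize X.fst = t at *
  rw [abs_le] at h h0 h1 h2 hx0
  -- Removing the signs: `11/16 ± 1/16` gives `[5/8, 3/4]` here, and `3/16 ± 1/16` gives `[1/8,
  -- 1/4]` for `z`.
  obtain ⟨y, hy1, hy2, hyx⟩ : ∃ y, 5 / 8 * N ≤ y ∧ y ≤ 3 / 4 * N ∧ x0 = signVal s * y := by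
    rcases signVal_eq s with hs | hs <;> rw [hs] at h0 ⊢
    · exact ⟨x0, by linarith, by linarith, by ring⟩
    · exact ⟨-x0, by linarith, by linarith, by ring⟩
  obtain ⟨z, hz1, hz2, hzx⟩ : ∃ z, r / 8 ≤ z ∧ z ≤ r / 4 ∧ x1 = κ * (signVal s * z) := by
    rcases signVal_eq s with hs | hs <;> rcases hκ with hk | hk <;> rw [hs, hk] at h1 ⊢
    · exact ⟨x1, by linarith, by linarith, by ring⟩
    · exact ⟨-x1, by linarith, by linarith, by ring⟩
    · exact ⟨-x1, by linarith, by linarith, by ring⟩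
    · exact ⟨x1, by linarith, by linarith, by ring⟩
  have hs2 := signVal_sq s
  have hκ2 : κ ^ 2 = 1 := by rcases hκ with hk | hk <;> rw [hk] <;> norm_num
  have hx0sq : x0 ^ 2 = y ^ 2 := by rw [hyx, mul_pow, hs2, one_mul]
  have hx1sq : x1 ^ 2 = z ^ 2 := by rw [hzx, mul_pow, mul_pow, hs2, hκ2, one_mul, one_mul]
  have hz3 : z ^ 2 ≤ r ^ 2 / 16 := by
    have := pow_le_pow_left₀ (by linarith) hz2 2
    linarith [div_pow r 4 2]
  have hx2sq : x2 ^ 2 ≤ r ^ 2 / 256 := by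
    have := sq_le_sq' (by linarith [h2.1]) h2.2
    linarith [div_pow r 16 2]
  have hy3 : y ^ 2 ≤ 9 / 16 * N ^ 2 := by
    have := pow_le_pow_left₀ (by linarith) hy2 2
    linarith [mul_pow (3 / 4) N 2]
  have hrN2 : r ^ 2 ≤ N ^ 2 := by
    rw [hrN, sq]
    exact mul_le_mul_of_nonneg_left hLN hN.le
  have hyn : y ≤ n := by
    refine le_of_sq_le_sq ?_ hnn
    linarith [sq_nonneg z, sq_nonneg x2]
  have hdiff : n - y ≤ L / 2 := by
    have hmul : (n - y) * (n + y) = z ^ 2 + x2 ^ 2 := by linear_combination hn + hx0sq + hx1sq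
    by_contra hcon
    push Not at hcon
    have : L / 2 * (5 / 4 * N) ≤ (n - y) * (n + y) :=
      mul_le_mul hcon.le (by linarith) (by positivity) (by linarith)
    linarith [mul_pos hN hL, mul_comm N L]
  refine ⟨⟨by linarith, ?_, ?_⟩, htube (by linarith [sq_nonneg r]), ?_⟩
  · refine le_of_sq_le_sq ?_ hN.le
    linarith [sq_nonneg N]
  · have hsn : signVal s * n = x0 + signVal s * (n - y) := by rw [hyx]; ring
    rw [hsn, abs_le]
    rcases signVal_eq s with hs | hs <;> rw [hs] <;> constructor <;> linarith
  · rw [hzx]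
    calc r / 8 ≤ z := hz1
      _ = κ ^ 2 * signVal s ^ 2 * z := by rw [hκ2, hs2]; ring
      _ = _ := by ring

/-- The angle dominates the chord, since `2 - 2 cos θ ≤ θ²`, and the chord dominates its component
along `b 1`, to which each unit vector contributes `r/(8N)` with opposite sign. -/
theorem le_theta12 (b : OrthonormalBasis (Fin 3) ℝ Space3) {N r : ℝ} (hr : 0 < r) (s₁ s₂ : ℤˣ)
    {X₁ X₂ : SpaceTime} (hX₁ : ‖X₁.snd‖ ≤ N) (hX₂ : ‖X₂.snd‖ ≤ N)
    (h₁ : r / 8 ≤ signVal s₁ * b.repr X₁.snd 1) (h₂ : r / 8 ≤ -(signVal s₂ * b.repr X₂.snd 1)) :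
    r / (4 * N) ≤ theta12 s₁ s₂ X₁ X₂ := by
  have hpos : ∀ (s : ℤˣ) (ξ : Space3), r / 8 ≤ |signVal s * b.repr ξ 1| → 0 < ‖ξ‖ := by
    intro s ξ h
    rw [abs_mul, abs_signVal, one_mul] at h
    have := abs_repr_le_norm b ξ 1
    linarith
  have hp₁ := hpos s₁ _ (h₁.trans (le_abs_self _))
  have hp₂ := hpos s₂ _ (h₂.trans (neg_le_abs _))
  have hN : 0 < N := hp₁.trans_le hX₁
  refine le_of_sq_le_sq ?_ (theta12_nonneg _ _ _ _)
  have hD := two_sub_two_cos_angle s₁ s₂ b (norm_pos_iff.1 hp₁) (norm_pos_iff.1 hp₂)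
  have hcos := Real.one_sub_sq_div_two_le_cos (x := theta12 s₁ s₂ X₁ X₂)
  have e₁ : r / 8 / N ≤ signVal s₁ * (b.repr X₁.snd 1 / ‖X₁.snd‖) := by
    rw [← mul_div_assoc]
    exact div_le_div₀ (by linarith) h₁ hp₁ hX₁
  have e₂ : r / 8 / N ≤ -(signVal s₂ * (b.repr X₂.snd 1 / ‖X₂.snd‖)) := by
    rw [← mul_div_assoc, ← neg_div]
    exact div_le_div₀ (by linarith) h₂ hp₂ hX₂
  have e₃ : r / (4 * N) ≤ signVal s₁ * (b.repr X₁.snd 1 / ‖X₁.snd‖) -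
      signVal s₂ * (b.repr X₂.snd 1 / ‖X₂.snd‖) := by
    have : r / (4 * N) = r / 8 / N + r / 8 / N := by field_simp; norm_num
    linarith
  have e₄ := pow_le_pow_left₀ (by positivity) e₃ 2
  have : theta12 s₁ s₂ X₁ X₂ =
    InnerProductGeometry.angle (signVal s₁ • X₁.snd) (signVal s₂ • X₂.snd) := rfl
  rw [← this] at hD
  linarith [sq_nonneg (signVal s₁ * (b.repr X₁.snd 0 / ‖X₁.snd‖) -
      signVal s₂ * (b.repr X₂.snd 0 / ‖X₂.snd‖)), sq_nonneg (signVal s₁ *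
      (b.repr X₁.snd 2 / ‖X₁.snd‖) - signVal s₂ * (b.repr X₂.snd 2 / ‖X₂.snd‖))]

/-- The indicator function of a measurable set of finite measure is a Fourier transform. -/
theorem exists_fourierHat_eq_indicator {A : Set SpaceTime} (hA : MeasurableSet A)
    (hfin : volume A ≠ ⊤) : ∃ u : L2SpaceTime, fourierHat u =ᵐ[volume] A.indicator 1 ∧
      (2 * Real.pi) ^ 4 * ‖u‖ ^ 2 = volume.real A := by
  have hsq : ∫⁻ X, ‖A.indicator (1 : SpaceTime → ℂ) X‖ₑ ^ 2 = volume A := by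
    rw [← lintegral_indicator_one hA]
    congr 1 with X
    by_cases h : X ∈ A <;> simp [h]
  obtain ⟨u, hu⟩ := exists_fourierHat_eq (measurable_one.indicator hA) (hsq ▸ hfin.lt_top)
  refine ⟨u, hu, ?_⟩
  rw [lintegral_enorm_sq_of_fourierHat_eq hu] at hsq
  rw [measureReal_def, ← hsq, ENNReal.toReal_mul, ENNReal.toReal_ofReal (by positivity),
    ENNReal.toReal_pow, toReal_enorm]

theorem volume_preimage_sub (p : SpaceTime) {Q : Set SpaceTime} (hQ : MeasurableSet Q) :
    volume ((fun X => X - p) ⁻¹' Q) = volume Q :=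
  (measurePreserving_sub_right volume p).measure_preimage hQ.nullMeasurableSet

theorem volume_preimage_two_smul_sub (p : SpaceTime) {Q : Set SpaceTime} (hQ : MeasurableSet Q) :
    volume ((fun X => (2 : ℝ) • (X - p)) ⁻¹' Q) = ENNReal.ofReal (1 / 16) * volume Q := by
  have h4 : Module.finrank ℝ SpaceTime = 4 := by
    rw [(WithLp.linearEquiv 2 ℝ (ℝ × Space3)).finrank_eq]
    simp
  have h : (fun X : SpaceTime => (2 : ℝ) • (X - p)) ⁻¹' Q =
      (fun X => X - p) ⁻¹' ((fun X => (2 : ℝ) • X) ⁻¹' Q) := rfl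
  rw [h, volume_preimage_sub p (measurable_const_smul (2 : ℝ) hQ),
    Measure.addHaar_preimage_smul volume two_ne_zero, h4]
  norm_num

/-- If both factors are indicator functions on the Fourier side and `θ₁₂ ≥ δ` on the product of the
two sets, the null form is bounded below by `δ` times the measure of any set of admissible `X₁`. -/
theorem le_norm_integral_nullFormIntegrand {s₁ s₂ : ℤˣ} {u₁ u₂ : L2SpaceTime} {A B S : Set SpaceTime}
    (h₁ : fourierHat u₁ =ᵐ[volume] A.indicator 1) (h₂ : fourierHat u₂ =ᵐ[volume] B.indicator 1)
    {δ : ℝ} (hδ : ∀ X₁ ∈ A, ∀ X₂ ∈ B, δ ≤ theta12 s₁ s₂ X₁ X₂) {X₀ : SpaceTime}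
    (hS : MeasurableSet S) (hSA : ∀ X₁ ∈ S, X₁ ∈ A ∧ X₀ - X₁ ∈ B) (hSfin : volume S ≠ ⊤)
    (hint : Integrable (nullFormIntegrand s₁ s₂ u₁ u₂ X₀) volume) :
    δ * volume.real S ≤ ‖∫ X₁, nullFormIntegrand s₁ s₂ u₁ u₂ X₀ X₁‖ := by
  set φ : SpaceTime → ℝ := fun X₁ =>
    theta12 s₁ s₂ X₁ (X₀ - X₁) * A.indicator 1 X₁ * B.indicator 1 (X₀ - X₁)
  have hφ0 : ∀ X₁, 0 ≤ φ X₁ := fun X₁ =>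
    mul_nonneg (mul_nonneg (theta12_nonneg _ _ _ _) (indicator_nonneg (by simp) _))
      (indicator_nonneg (by simp) _)
  have heq : nullFormIntegrand s₁ s₂ u₁ u₂ X₀ =ᵐ[volume] fun X₁ => (φ X₁ : ℂ) := by
    filter_upwards [h₁, (Measure.measurePreserving_sub_left volume X₀).quasiMeasurePreserving.ae h₂]
      with X₁ e₁ e₂
    rw [nullFormIntegrand, e₁, e₂]
    by_cases hA : X₁ ∈ A <;> by_cases hB : X₀ - X₁ ∈ B <;> simp [φ, hA, hB]
  have hφint : Integrable φ volume := by
    have := (hint.congr heq).re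
    simpa using this
  rw [integral_congr_ae heq, integral_complex_ofReal, Complex.norm_real, Real.norm_eq_abs,
    abs_of_nonneg (integral_nonneg hφ0)]
  calc δ * volume.real S = ∫ X₁, S.indicator (fun _ => δ) X₁ := by
        rw [integral_indicator hS, setIntegral_const, smul_eq_mul, mul_comm]
    _ ≤ ∫ X₁, φ X₁ := by
        refine integral_mono ((integrable_indicator_iff hS).2 (integrableOn_const hSfin)) hφint
          fun X₁ => ?_
        by_cases hX : X₁ ∈ S
        · obtain ⟨hA, hB⟩ := hSA X₁ hX
          simpa [φ, hX, hA, hB] using hδ X₁ hA _ hB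
        · simpa [hX] using hφ0 X₁

/-- The Knapp type example which saturates the null form estimate. -/
theorem exists_isNullForm_le_norm (s₁ s₂ : ℤˣ) {N L : ℝ} {ω : Space3} (hL : 0 < L) (hLN : L ≤ N)
    (hω : ‖ω‖ = 1) :
    ∃ u₁ u₂ b : L2SpaceTime,
      u₁ ≠ 0 ∧ u₂ ≠ 0 ∧
      FourierSupportedIn u₁ (thickCone s₁ N L) ∧
      FourierSupportedIn u₂ (thickCone s₂ N L) ∧
      IsNullForm s₁ s₂
        (fourierProj (measurableSet_spaceTimeTube (Real.sqrt (N * L)) ω) u₁) u₂ b ∧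
      (2 * Real.pi) ^ 2 / 2 ^ 13 * Real.sqrt (Real.sqrt (N * L) ^ 2 * L * L) * ‖u₁‖ * ‖u₂‖ ≤ ‖b‖ := by
  have hN : 0 < N := hL.trans_le hLN
  have hr : 0 < Real.sqrt (N * L) := Real.sqrt_pos.2 (by positivity)
  have hrN : Real.sqrt (N * L) ^ 2 = N * L := Real.sq_sqrt (by positivity)
  set r := Real.sqrt (N * L)
  obtain ⟨b, hb⟩ := exists_orthonormalBasis_apply_zero_eq hω
  set Q := knappBox b L N r
  have hQ : MeasurableSet Q := measurableSet_knappBox b L N r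
  have hQvol : volume Q = ENNReal.ofReal (L ^ 2 * N ^ 2 / 512) := by
    rw [volume_knappBox b hL hN hr, hrN]
    congr 1; ring
  set V := L ^ 2 * N ^ 2 / 512 with hV
  have hVpos : 0 < V := by positivity
  -- The values `κ = ±1` put the signed frequencies on opposite sides of the axis, which keeps `θ₁₂`
  -- at least `r/(4N)`.
  set p := knappCenter b N r s₁ 1
  set q := knappCenter b N r s₂ (-1)
  set A := (fun X => X - p) ⁻¹' Q
  set B := (fun X => X - q) ⁻¹' Q
  have hA : MeasurableSet A := (measurable_id.sub_const p) hQ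
  have hB : MeasurableSet B := (measurable_id.sub_const q) hQ
  have hAvol : volume A = ENNReal.ofReal V := (volume_preimage_sub p hQ).trans hQvol
  have hBvol : volume B = ENNReal.ofReal V := (volume_preimage_sub q hQ).trans hQvol
  have hAmem : ∀ X ∈ A, X ∈ thickCone s₁ N L ∧ X ∈ spaceTimeTube r ω ∧
      r / 8 ≤ 1 * (signVal s₁ * b.repr X.snd 1) := fun X hX =>
    mem_thickCone_of_sub_mem_knappBox hb hL hLN hr hrN s₁ (Or.inl rfl) hX
  have hBmem : ∀ X ∈ B, X ∈ thickCone s₂ N L ∧ X ∈ spaceTimeTube r ω ∧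
      r / 8 ≤ -1 * (signVal s₂ * b.repr X.snd 1) := fun X hX =>
    mem_thickCone_of_sub_mem_knappBox hb hL hLN hr hrN s₂ (Or.inr rfl) hX
  obtain ⟨u₁, hu₁, hn₁⟩ := exists_fourierHat_eq_indicator hA (by simp [hAvol])
  obtain ⟨u₂, hu₂, hn₂⟩ := exists_fourierHat_eq_indicator hB (by simp [hBvol])
  rw [measureReal_def, hAvol, ENNReal.toReal_ofReal hVpos.le] at hn₁
  rw [measureReal_def, hBvol, ENNReal.toReal_ofReal hVpos.le] at hn₂
  have hsupp₁ : FourierSupportedIn u₁ (thickCone s₁ N L) := by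
    filter_upwards [hu₁] with X hX hnot
    rw [hX, indicator_of_notMem fun h => hnot (hAmem X h).1]
  have hsupp₂ : FourierSupportedIn u₂ (thickCone s₂ N L) := by
    filter_upwards [hu₂] with X hX hnot
    rw [hX, indicator_of_notMem fun h => hnot (hBmem X h).1]
  -- Only the existence of the null form is taken from the upper bound.
  obtain ⟨w, hw, -⟩ := exists_isNullForm_norm_le s₁ s₂ hN hN hL hL hr hω hsupp₁ hsupp₂
  refine ⟨u₁, u₂, w, ?_, ?_, hsupp₁, hsupp₂, hw, ?_⟩
  · rintro rfl
    simp at hn₁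
    exact hVpos.ne hn₁
  · rintro rfl
    simp at hn₂
    exact hVpos.ne hn₂
  have hproj : fourierHat (fourierProj (measurableSet_spaceTimeTube r ω) u₁) =ᵐ[volume]
      A.indicator 1 := by
    filter_upwards [fourierHat_fourierProj (measurableSet_spaceTimeTube r ω) u₁, hu₁] with X e₁ e₂
    rw [e₁]
    by_cases hX : X ∈ A
    · rw [indicator_of_mem (hAmem X hX).2.1, e₂]
    · rw [indicator_of_notMem hX]
      exact indicator_apply_eq_zero.2 fun _ => by rw [e₂, indicator_of_notMem hX]
  -- For `X₀ ∈ T`, all of `S` is admissible; halving the box in dimension 4 costs the factor `1/16`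
  -- in both measures.
  set S := (fun X => (2 : ℝ) • (X - p)) ⁻¹' Q
  set T := (fun X => (2 : ℝ) • (X - (p + q))) ⁻¹' Q
  have hm : ∀ c : SpaceTime, Measurable fun X : SpaceTime => (2 : ℝ) • (X - c) := fun c =>
    Continuous.measurable (by fun_prop)
  have hSvol : volume S = ENNReal.ofReal (V / 16) := by
    rw [volume_preimage_two_smul_sub p hQ, hQvol, ← ENNReal.ofReal_mul (by norm_num)]
    congr 1; ring
  have hTvol : volume T = ENNReal.ofReal (V / 16) := by
    rw [volume_preimage_two_smul_sub (p + q) hQ, hQvol, ← ENNReal.ofReal_mul (by norm_num)]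
    congr 1; ring
  have hlow : ∀ᵐ X₀, X₀ ∈ T → ENNReal.ofReal ((r / (4 * N) * (V / 16)) ^ 2) ≤
      ‖fourierHat w X₀‖ₑ ^ 2 := by
    filter_upwards [hw] with X₀ h₀ hT
    have hle := le_norm_integral_nullFormIntegrand (δ := r / (4 * N)) (S := S) (X₀ := X₀) hproj hu₂
      (fun X₁ h₁ X₂ h₂ => le_theta12 b hr s₁ s₂ (hAmem X₁ h₁).1.2.1 (hBmem X₂ h₂).1.2.1
        (by linarith [(hAmem X₁ h₁).2.2]) (by linarith [(hBmem X₂ h₂).2.2])) (hm p hQ)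
      (fun X₁ h₁ => ⟨mem_knappBox_of_two_smul_self h₁, ?_⟩) (by simp [hSvol]) h₀.1
    · rw [← h₀.2, measureReal_def, hSvol, ENNReal.toReal_ofReal (by positivity)] at hle
      rw [← ofReal_norm, ← ENNReal.ofReal_pow (norm_nonneg _)]
      exact ENNReal.ofReal_le_ofReal (pow_le_pow_left₀ (by positivity) hle 2)
    · have := mem_knappBox_of_two_smul hT h₁
      have e : X₀ - X₁ - q = X₀ - (p + q) - (X₁ - p) := by abel
      change X₀ - X₁ - q ∈ Q
      rwa [e]
  have hTint : ENNReal.ofReal ((r / (4 * N) * (V / 16)) ^ 2) * volume T ≤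
      ∫⁻ X₀, ‖fourierHat w X₀‖ₑ ^ 2 := by
    rw [← setLIntegral_const, ← lintegral_indicator (hm _ hQ)]
    refine lintegral_mono_ae ?_
    filter_upwards [hlow] with X₀ h₀
    by_cases hX : X₀ ∈ T
    · rw [indicator_of_mem hX]
      exact h₀ hX
    · rw [indicator_of_notMem hX]
      exact zero_le
  rw [lintegral_enorm_sq_fourierHat, hTvol, ← ofReal_norm, ← ENNReal.ofReal_pow (norm_nonneg _),
    ← ENNReal.ofReal_mul (by positivity), ← ENNReal.ofReal_mul (by positivity),
    ENNReal.ofReal_le_ofReal_iff (by positivity)] at hTint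
  refine le_of_sq_le_sq ?_ (norm_nonneg _)
  have hsqrt : Real.sqrt (r ^ 2 * L * L) ^ 2 = r ^ 2 * L * L := Real.sq_sqrt (by positivity)
  have hP : 0 < (2 * Real.pi) ^ 4 := by positivity
  refine le_of_mul_le_mul_left (le_trans ?_ hTint) hP
  calc (2 * Real.pi) ^ 4 * ((2 * Real.pi) ^ 2 / 2 ^ 13 * Real.sqrt (r ^ 2 * L * L) * ‖u₁‖ *
        ‖u₂‖) ^ 2
      = 1 / 2 ^ 26 * Real.sqrt (r ^ 2 * L * L) ^ 2 * ((2 * Real.pi) ^ 4 * ‖u₁‖ ^ 2) *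
          ((2 * Real.pi) ^ 4 * ‖u₂‖ ^ 2) := by ring
    _ = r ^ 2 * V ^ 2 * (L ^ 2 / 2 ^ 26) := by rw [hsqrt, hn₁, hn₂]; ring
    -- Here `L² = 2⁹ V / N²` is substituted; a factor 2 is then given away to match `(r/(4N) ·
    -- V/16)² · V/16 = r² V³ / (2¹⁶ N²)`.
    _ = r ^ 2 * V ^ 2 * (V / (2 ^ 17 * N ^ 2)) := by
        rw [hV]; field_simp; norm_num
    _ ≤ r ^ 2 * V ^ 2 * (V / (2 ^ 16 * N ^ 2)) := by
        gcongr <;> norm_num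
    _ = _ := by field_simp; norm_num

/-! ### The theorem -/

/-- Null form estimate with a tube restriction on the first factor, together with its optimality up
to an absolute factor (for input frequencies of size `N`, cones of thickness `L ≤ N`, and a tube of
radius `√(N L)`). -/
theorem theoremN :
    (∃ C : ℝ, 0 < C ∧
      ∀ (s₁ s₂ : ℤˣ) (N₁ N₂ L₁ L₂ r : ℝ) (ω : Space3) (u₁ u₂ : L2SpaceTime),
        0 < N₁ → 0 < N₂ → 0 < L₁ → 0 < L₂ → 0 < r → ‖ω‖ = 1 →
        FourierSupportedIn u₁ (thickCone s₁ N₁ L₁) →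
        FourierSupportedIn u₂ (thickCone s₂ N₂ L₂) →
        ∃ b : L2SpaceTime,
          IsNullForm s₁ s₂ (fourierProj (measurableSet_spaceTimeTube r ω) u₁) u₂ b ∧
          ‖b‖ ≤ C * Real.sqrt (r ^ 2 * L₁ * L₂) * ‖u₁‖ * ‖u₂‖) ∧
    (∃ c : ℝ, 0 < c ∧
      ∀ (s₁ s₂ : ℤˣ) (N L : ℝ) (ω : Space3),
        0 < L → L ≤ N → ‖ω‖ = 1 →
        ∃ u₁ u₂ b : L2SpaceTime,
          u₁ ≠ 0 ∧ u₂ ≠ 0 ∧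
          FourierSupportedIn u₁ (thickCone s₁ N L) ∧
          FourierSupportedIn u₂ (thickCone s₂ N L) ∧
          IsNullForm s₁ s₂
            (fourierProj (measurableSet_spaceTimeTube (Real.sqrt (N * L)) ω) u₁) u₂ b ∧
          c * Real.sqrt (Real.sqrt (N * L) ^ 2 * L * L) * ‖u₁‖ * ‖u₂‖ ≤ ‖b‖) :=
  ⟨⟨40 * (2 * Real.pi) ^ 2, by positivity,
      fun s₁ s₂ _ _ _ _ _ _ _ _ hN₁ hN₂ hL₁ hL₂ hr hω h₁ h₂ =>
        exists_isNullForm_norm_le s₁ s₂ hN₁ hN₂ hL₁ hL₂ hr hω h₁ h₂⟩,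
    ⟨(2 * Real.pi) ^ 2 / 2 ^ 13, by positivity,
      fun s₁ s₂ _ _ _ hL hLN hω => exists_isNullForm_le_norm s₁ s₂ hL hLN hω⟩⟩
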